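/- **Conventions.** A category with weak equivalences is a category $\mathcal C$ with a class $W$ of morphisms that contains all isomorphisms and has the two-out-of-three property; $\gamma:\mathcal C\to Ho(\mathcal C)=\mathcal C[W^{-1}]$ is its localization. For a small category $K$, $Fun(K,\mathcal C)$ carries the objectwise weak equivalences. A model category is assumed to have all small limits and colimits. A *left model approximation* of $\mathcal C$ is a model category $\mathcal M$ with an adjunction $l:\mathcal M\rightleftarrows\mathcal C:r$ ($l$ left adjoint to $r$) such that $r$ preserves weak equivalences, $l$ sends weak equivalences between cofibrant objects to weak equivalences, and, for every cofibrant $X\in\mathcal M$ and every $A\in\mathcal C$, the adjoint $lX\to A$ of any weak equivalence $X\to rA$ is a weak equivalence. If $\mathcal C$ is closed under (small) colimits, a *(rigid) homotopy colimit* over a small category $K$ is a functor $hocolim_K:Fun(K,\mathcal C)\to\mathcal C$ with a natural transformation $hocolim_K\to colim_K$ such that $\gamma\circ hocolim_K$, with the induced transformation $\gamma\circ hocolim_K\to\gamma\circ colim_K$, is the total left derived functor of $colim_K$, that is, the left derived functor of $\gamma\circ colim_K$ with respect to objectwise weak equivalences. **Theorem (Fubini theorem for homotopy colimits).** Let $\mathcal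 C$ be a category with weak equivalences that is closed under colimits, and let $l:\mathcal M\rightleftarrows\mathcal C:r$ be a left model approximation such that $\mathcal M$ has a functorial factorization of morphisms into cofibrations followed by acyclic fibrations. Let $I$ and $J$ be small categories. Then rigid homotopy colimits $hocolim_{I\times J}$, $hocolim_I$ and $hocolim_J$ exist, and, for any choice of them and every $F:I\times J\to\mathcal C$, there are weak equivalences, natural in $F$, $$hocolim_{I\times J}F\;\simeq\;hocolim_{I}\,hocolim_{J}F\;\simeq\;hocolim_{J}\,hocolim_{I}F,$$ where $hocolim_JF$ is the diagram $i\mapsto hocolim_J F(i,-)$ on $I$, $hocolim_IF$ is the diagram $j\mapsto hocolim_I F(-,j)$ on $J$, and $\simeq$ means being connected by a finite zigzag of (natural) weak equivalences. -/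

import Mathlib

open CategoryTheory Limits HomotopicalAlgebra

universe w v v₁ v₂ u u₁ u₂

namespace HocolimFubini

/-- A category with weak equivalences: a class `W` of morphisms that contains all isomorphisms
and satisfies the two out of three property. -/
structure IsWeakEquivalenceClass {C : Type u} [Category.{v} C] (W : MorphismProperty C) :
    Prop where
  isomorphisms_le : MorphismProperty.isomorphisms C ≤ W
  twoOutOfThree : W.HasTwoOutOfThreeProperty

/-- An adjunction `l ⊣ r` between a model category `M` and a category `C` with weak
equivalences `W` is a left model approximation of `C`. -/
structure IsLeftModelApproximation {M : Type u₁} [Category.{v₁} M] [ModelCategory M]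
    {C : Type u₂} [Category.{v₂} C] (W : MorphismProperty C)
    {l : M ⥤ C} {r : C ⥤ M} (adj : l ⊣ r) : Prop where
  /-- `r` sends weak equivalences to weak equivalences -/
  map_right : ∀ ⦃A B : C⦄ (f : A ⟶ B), W f → WeakEquivalence (r.map f)
  /-- `l` sends weak equivalences between cofibrant objects to weak equivalences -/
  map_left : ∀ ⦃X Y : M⦄ (f : X ⟶ Y), IsCofibrant X → IsCofibrant Y →
    WeakEquivalence f → W (l.map f)
  /-- the adjoint of a weak equivalence `X ⟶ r A` with `X` cofibrant is a weak equivalence -/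
  adjoint : ∀ ⦃X : M⦄ ⦃A : C⦄ (f : X ⟶ r.obj A), IsCofibrant X →
    WeakEquivalence f → W ((adj.homEquiv X A).symm f)

/-- A (rigid) homotopy colimit over `K` of diagrams in a category `C` with weak equivalences `W`:
a functor `(K ⥤ C) ⥤ C` with a natural transformation to `colim`, whose composite with the
localization functor `W.Q : C ⥤ Ho(C)` is the total left derived functor of
`colim : (K ⥤ C) ⥤ C`, i.e. the left derived functor of `colim ⋙ W.Q`
with respect to the objectwise weak equivalences. -/
structure RigidHocolim {C : Type u} [Category.{v} C] (W : MorphismProperty C)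
    (K : Type w) [Category.{w} K] [HasColimitsOfShape K C] where
  /-- the homotopy colimit, as a functor with values in `C` -/
  functor : (K ⥤ C) ⥤ C
  /-- the natural transformation to the colimit -/
  toColim : functor ⟶ colim
  isTotalLeftDerived :
    ∃ (H : (W.functorCategory K).Localization ⥤ W.Localization)
      (e : (W.functorCategory K).Q ⋙ H ≅ functor ⋙ W.Q),
      H.IsLeftDerivedFunctor (F := colim ⋙ W.Q)
        (e.hom ≫ Functor.whiskerRight toColim W.Q) (W.functorCategory K)

/-- Two objects are weakly equivalent if they are connected by a finite zigzag of morphisms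
in `W`. -/
def WeaklyEquivalent {C : Type u} [Category.{v} C] (W : MorphismProperty C) (X Y : C) : Prop :=
  Relation.EqvGen (fun A B : C => ∃ f : A ⟶ B, W f) X Y

/-- Naturally (i.e. objectwise) weakly equivalent functors have weakly equivalent values. -/
theorem WeaklyEquivalent.app {D : Type u₁} [Category.{v₁} D] {C : Type u₂} [Category.{v₂} C]
    {W : MorphismProperty C} {G H : D ⥤ C} (h : WeaklyEquivalent (W.functorCategory D) G H)
    (F : D) : WeaklyEquivalent W (G.obj F) (H.obj F) := by
  induction h with
  | rel _ _ h => obtain ⟨f, hf⟩ := h; exact .rel _ _ ⟨f.app F, hf F⟩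
  | refl => exact .refl _
  | symm _ _ _ ih => exact .symm _ _ ih
  | trans _ _ _ _ _ ih₁ ih₂ => exact .trans _ _ _ ih₁ ih₂

variable {C : Type u} [Category.{v} C] {I J : Type w} [Category.{w} I] [Category.{w} J]

/-- Given `hI : (I ⥤ C) ⥤ C` and `hJ : (J ⥤ C) ⥤ C`, the functor
`F ↦ hI (i ↦ hJ (F (i, -)))` on diagrams `F : I × J ⥤ C`. -/
def iterate (hI : (I ⥤ C) ⥤ C) (hJ : (J ⥤ C) ⥤ C) : (I × J ⥤ C) ⥤ C :=
  Functor.curry ⋙ (Functor.whiskeringRight I (J ⥤ C) C).obj hJ ⋙ hI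

/-- Given `hI : (I ⥤ C) ⥤ C` and `hJ : (J ⥤ C) ⥤ C`, the functor
`F ↦ hJ (j ↦ hI (F (-, j)))` on diagrams `F : I × J ⥤ C`. -/
def iterate' (hI : (I ⥤ C) ⥤ C) (hJ : (J ⥤ C) ⥤ C) : (I × J ⥤ C) ⥤ C :=
  (Functor.whiskeringLeft (J × I) (I × J) C).obj (CategoryTheory.Prod.swap J I) ⋙ iterate hJ hI

end HocolimFubini

/-! For strict colimits the iterated and total colimits agree, both being left adjoint to constant
diagrams. So it suffices to resolve diagrams in a way that makes all colimits involved homotopically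
correct at once: a functor `Θ` on `K ⥤ C` with a natural weak equivalence to the identity.

Since `Telescope K` is direct, diagrams in `M` on it have functorial projective resolutions, built
degree by degree (`exists_factorization`, `nonempty_replacement`). `Θ` applies `r`, restricts to the
telescope, resolves, left Kan extends to `K` and applies `l`. The comma categories of the telescope
contract, up to a zigzag of natural transformations, onto a base point; hence the Kan extension
recovers the original diagram up to weak equivalence (`weakEquivalences_of_isColimit`,
`mem_telescope_homEquiv_symm`).

No model structure on `K ⥤ C` is needed. `IsGood` says that a left adjoint already computes its
derived functor at an object; weak equivalences between good objects go to isomorphisms in the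
homotopy category (`IsGood.isIso_Q_map`). Ken Brown's lemma on direct diagrams
(`preservesWeakBetween_of_adjunction`) and `isGood_map_of_replacement` make resolved diagrams good.
Hence `Θ ⋙ colim` is a homotopy colimit, and by uniqueness of derived functors any homotopy colimit
agrees with the colimit on good diagrams (`RigidHocolim.toColim_mem_of_isGood`).

On `I × J`, a resolved diagram is good for objectwise colimits over `J`, and these colimits form a
good diagram on `I`; so iterated homotopy colimits agree with iterated colimits there
(`iterateToColim_mem`). As `W` is saturated, every functor `G` being compared preserves weak
equivalences, and the zigzag `G ← Θ ⋙ G → Θ ⋙ colim` connects all of them. -/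

namespace HocolimFubini

/-! ### Functors inverting weak equivalences, acting on morphisms of the localization. -/

section Localization

variable {A : Type*} [Category* A] {W : MorphismProperty A}

/-- A natural transformation between functors on the localization which is defined on objects of
the original category is natural with respect to all the morphisms in the localization. -/
lemma localization_naturality {E : Type*} [Category* E] {H₁ H₂ : W.Localization ⥤ E}
    (τ : W.Q ⋙ H₁ ⟶ W.Q ⋙ H₂) {X Y : A} (φ : W.Q.obj X ⟶ W.Q.obj Y) :
    H₁.map φ ≫ τ.app Y = τ.app X ≫ H₂.map φ := by
  have h := (Localization.liftNatTrans W.Q W (W.Q ⋙ H₁) (W.Q ⋙ H₂) H₁ H₂ τ).naturality φ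
  simpa [Localization.liftNatTrans_app] using h

/-- The action of a functor which inverts `W` on morphisms in the localization. -/
noncomputable def locMap {E : Type*} [Category* E] (G : A ⥤ E) (hG : W.IsInvertedBy G) {X Y : A}
    (φ : W.Q.obj X ⟶ W.Q.obj Y) : G.obj X ⟶ G.obj Y :=
  (Localization.fac G hG W.Q).inv.app X ≫ (Localization.lift G hG W.Q).map φ ≫
    (Localization.fac G hG W.Q).hom.app Y

variable {E E' : Type*} [Category* E] [Category* E'] (G G' : A ⥤ E) (hG : W.IsInvertedBy G)
  (hG' : W.IsInvertedBy G')

@[simp]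
lemma locMap_map {X Y : A} (f : X ⟶ Y) : locMap G hG (W.Q.map f) = G.map f := by
  have := (Localization.fac G hG W.Q).hom.naturality f
  dsimp only [Functor.comp_map] at this
  rw [locMap, this, Iso.inv_hom_id_app_assoc]

@[simp]
lemma locMap_comp {X Y Z : A} (φ : W.Q.obj X ⟶ W.Q.obj Y) (ψ : W.Q.obj Y ⟶ W.Q.obj Z) :
    locMap G hG (φ ≫ ψ) = locMap G hG φ ≫ locMap G hG ψ := by
  simp [locMap]

/-- Any two extensions of `G` to the localization are canonically isomorphic, so every choice of
extension may be used to compute `locMap`. -/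
lemma locMap_eq (H : W.Localization ⥤ E) (e : W.Q ⋙ H ≅ G) {X Y : A}
    (φ : W.Q.obj X ⟶ W.Q.obj Y) :
    locMap G hG φ = e.inv.app X ≫ H.map φ ≫ e.hom.app Y := by
  have h := localization_naturality ((Localization.fac G hG W.Q).hom ≫ e.inv) φ
  have h' := h =≫ e.hom.app Y
  simp only [NatTrans.comp_app, Category.assoc, Iso.inv_hom_id_app, Category.comp_id] at h'
  rw [locMap, h', Iso.inv_hom_id_app_assoc]

variable {G G'} in
lemma locMap_naturality (τ : G ⟶ G') {X Y : A} (φ : W.Q.obj X ⟶ W.Q.obj Y) :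
    locMap G hG φ ≫ τ.app Y = τ.app X ≫ locMap G' hG' φ := by
  have h := localization_naturality
    ((Localization.fac G hG W.Q).hom ≫ τ ≫ (Localization.fac G' hG' W.Q).inv) φ
  have h' := h =≫ (Localization.fac G' hG' W.Q).hom.app Y
  simp only [NatTrans.comp_app, Category.assoc, Iso.inv_hom_id_app, Category.comp_id] at h'
  simp [locMap, h']

lemma locMap_Q {X Y : A} (φ : W.Q.obj X ⟶ W.Q.obj Y) :
    locMap W.Q (Localization.inverts W.Q W) φ = φ := by
  rw [locMap_eq _ _ (𝟭 _) (Functor.rightUnitor _)]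
  simp

lemma map_locMap (T : E ⥤ E') (hT : W.IsInvertedBy (G ⋙ T)) {X Y : A}
    (φ : W.Q.obj X ⟶ W.Q.obj Y) :
    T.map (locMap G hG φ) = locMap (G ⋙ T) hT φ := by
  rw [locMap_eq (G ⋙ T) _ (Localization.lift G hG W.Q ⋙ T)
    ((Functor.associator _ _ _).symm ≪≫
      Functor.isoWhiskerRight (Localization.fac G hG W.Q) T)]
  simp [locMap]

lemma isInvertedBy_comp_Q {B : Type*} [Category* B] {WB : MorphismProperty B} {F : A ⥤ B}
    (hF : W ≤ WB.inverseImage F) : W.IsInvertedBy (F ⋙ WB.Q) :=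
  fun _ _ f hf => Localization.inverts WB.Q WB _ (hF f hf)

lemma locMap_locMap {B : Type*} [Category* B] {WB : MorphismProperty B} (F : A ⥤ B)
    (hF : W.IsInvertedBy (F ⋙ WB.Q)) (T : B ⥤ E) (hT : WB.IsInvertedBy T)
    (hFT : W.IsInvertedBy (F ⋙ T)) {X Y : A} (φ : W.Q.obj X ⟶ W.Q.obj Y) :
    locMap T hT (locMap (F ⋙ WB.Q) hF φ) = locMap (F ⋙ T) hFT φ := by
  have hT' : W.IsInvertedBy ((F ⋙ WB.Q) ⋙ Localization.lift T hT WB.Q) := fun _ _ f hf => by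
    have := hF f hf
    rw [Functor.comp_map]
    infer_instance
  rw [locMap, map_locMap _ _ _ hT']
  have := locMap_naturality hT' hFT
    ((Functor.associator _ _ _).hom ≫ Functor.whiskerLeft F (Localization.fac T hT WB.Q).hom) φ
  simp only [NatTrans.comp_app, Functor.associator_hom_app, Functor.whiskerLeft_app,
    Category.id_comp] at this
  rw [this]
  simp

end Localization

/-! ### Pointwise derived adjunctions and good objects. -/

section Deformation

variable {N A B : Type*} [Category* N] [Category* A] [Category* B]
  {WN : MorphismProperty N} {WA : MorphismProperty A} {WB : MorphismProperty B}

/-- Given an adjunction `F ⊣ G` where `G` preserves weak equivalences, the object `X` is good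
if `F X` corepresents morphisms from `X` to `G b` in the homotopy categories. -/
def IsGood {F : A ⥤ B} {G : B ⥤ A} (adj : F ⊣ G) (hG : WB ≤ WA.inverseImage G) (X : A) : Prop :=
  ∀ b : B, Function.Bijective (fun φ : WB.Q.obj (F.obj X) ⟶ WB.Q.obj b =>
    WA.Q.map (adj.unit.app X) ≫ locMap (G ⋙ WA.Q) (isInvertedBy_comp_Q hG) φ)

/-- A functorial replacement of objects by objects satisfying a property `P`. -/
structure Replacement (W : MorphismProperty N) (P : ObjectProperty N) where
  /-- the replacement functor -/
  functor : N ⥤ N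
  /-- the natural weak equivalence to the identity -/
  hom : functor ⟶ 𝟭 N
  hom_mem (X : N) : W (hom.app X)
  obj_mem (X : N) : P (functor.obj X)

/-- A functor sends weak equivalences between objects satisfying `P` to weak equivalences. -/
def PreservesWeakBetween (WN : MorphismProperty N) (P : ObjectProperty N)
    (WA : MorphismProperty A) (L : N ⥤ A) : Prop :=
  ∀ ⦃X Y : N⦄ (f : X ⟶ Y), P X → P Y → WN f → WA (L.map f)

lemma Replacement.map_mem [WN.HasTwoOutOfThreeProperty] {P : ObjectProperty N}
    (R : Replacement WN P) ⦃X Y : N⦄ (f : X ⟶ Y) (hf : WN f) : WN (R.functor.map f) := by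
  have h := R.hom.naturality f
  refine (WN.postcomp_iff _ _ (R.hom_mem Y)).1 ?_
  rw [h]
  exact WN.comp_mem _ _ (R.hom_mem X) hf

/-- This is the derived adjunction: `Rep.functor ⋙ L` induces a left adjoint of `R` on homotopy
categories, and on objects satisfying `P` the replacement can be dropped because `L` inverts it. -/
theorem isGood_of_replacement [WN.HasTwoOutOfThreeProperty] {P : ObjectProperty N}
    (Rep : Replacement WN P) {L : N ⥤ A} {R : A ⥤ N} (adj : L ⊣ R)
    (hR : WA ≤ WN.inverseImage R) (hL : PreservesWeakBetween WN P WA L) (Y : N) (hY : P Y) :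
    IsGood adj hR Y := by
  intro a
  have hRQ : WA.IsInvertedBy (R ⋙ WN.Q) := isInvertedBy_comp_Q hR
  have hQL : WN.IsInvertedBy (Rep.functor ⋙ L ⋙ WA.Q) := fun _ _ f hf =>
    Localization.inverts WA.Q WA _ (hL _ (Rep.obj_mem _) (Rep.obj_mem _) (Rep.map_mem f hf))
  have hQ : WN.IsInvertedBy (Rep.functor ⋙ WN.Q) := fun _ _ f hf =>
    Localization.inverts WN.Q WN _ (Rep.map_mem f hf)
  have hRQL : WA.IsInvertedBy (R ⋙ Rep.functor ⋙ L ⋙ WA.Q) := fun _ _ f hf => hQL _ (hR _ hf)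
  have hQLR : WN.IsInvertedBy (Rep.functor ⋙ L ⋙ R ⋙ WN.Q) := fun _ _ f hf =>
    hRQ _ (hL _ (Rep.obj_mem _) (Rep.obj_mem _) (Rep.map_mem f hf))
  have hRQLR : WA.IsInvertedBy ((R ⋙ Rep.functor ⋙ L) ⋙ R ⋙ WN.Q) := fun _ _ f hf =>
    hQLR _ (hR _ hf)
  have iq : ∀ X, IsIso (WN.Q.map (Rep.hom.app X)) := fun X =>
    Localization.inverts WN.Q WN _ (Rep.hom_mem X)
  have iLq : IsIso (WA.Q.map (L.map (Rep.hom.app Y))) :=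
    Localization.inverts WA.Q WA _ (hL _ (Rep.obj_mem _) hY (Rep.hom_mem Y))
  -- The derived counit, from which the inverse bijection is built.
  let lam : R ⋙ Rep.functor ⋙ L ⟶ 𝟭 A :=
    { app := fun a => L.map (Rep.hom.app (R.obj a)) ≫ adj.counit.app a
      naturality := fun a b f => by
        have := Rep.hom.naturality (R.map f)
        simp only [Functor.id_map] at this
        simp only [Functor.comp_map, ← Functor.map_comp_assoc, this]
        simp }
  let un : Rep.functor ⟶ Rep.functor ⋙ L ⋙ R := Functor.whiskerLeft Rep.functor adj.unit
  refine Function.bijective_iff_has_inverse.2 ⟨fun ψ =>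
    inv (WA.Q.map (L.map (Rep.hom.app Y))) ≫ locMap (Rep.functor ⋙ L ⋙ WA.Q) hQL ψ ≫
      WA.Q.map (lam.app a), fun φ => ?_, fun ψ => ?_⟩
  · dsimp only
    rw [locMap_comp, locMap_map, locMap_locMap R _ _ _ hRQL, IsIso.inv_comp_eq, Category.assoc]
    have h := locMap_naturality hRQL (Localization.inverts WA.Q WA)
      (Functor.whiskerRight lam WA.Q) φ
    dsimp only [Functor.whiskerRight_app] at h
    rw [h, locMap_Q, ← Category.assoc]
    congr 1
    dsimp [lam]
    rw [← Functor.map_comp, ← Functor.map_comp_assoc]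
    have := Rep.hom.naturality (adj.unit.app Y)
    dsimp at this
    rw [this]
    simp
  -- Precomposing with the invertible replacement map moves the unit to the replaced object, where
  -- the derived triangle identity `h₅` finishes.
  · rw [← cancel_epi (WN.Q.map (Rep.hom.app Y))]
    have h₁ : WN.Q.map (Rep.hom.app Y) ≫ WN.Q.map (adj.unit.app Y) =
        WN.Q.map (adj.unit.app (Rep.functor.obj Y)) ≫
          (R ⋙ WN.Q).map (L.map (Rep.hom.app Y)) := by
      simp [← Functor.map_comp]
    have h₂ : (R ⋙ WN.Q).map (L.map (Rep.hom.app Y)) ≫ locMap (R ⋙ WN.Q) hRQ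
        (inv (WA.Q.map (L.map (Rep.hom.app Y)))) = 𝟙 _ := by
      rw [← locMap_map (R ⋙ WN.Q) hRQ, ← locMap_comp, IsIso.hom_inv_id, ← WA.Q.map_id,
        locMap_map, CategoryTheory.Functor.map_id]
    have h₃ := locMap_naturality hQ hQLR (Functor.whiskerRight un WN.Q) ψ
    have h₄ := locMap_naturality hQ (Localization.inverts WN.Q WN)
      (Functor.whiskerRight Rep.hom WN.Q) ψ
    have h₅ : WN.Q.map (adj.unit.app (Rep.functor.obj (R.obj a))) ≫
        (R ⋙ WN.Q).map (lam.app a) = WN.Q.map (Rep.hom.app (R.obj a)) := by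
      rw [Functor.comp_map, ← Functor.map_comp]
      simp [lam]
    rw [locMap_Q] at h₄
    dsimp only [un, Functor.whiskerRight_app, Functor.whiskerLeft_app] at h₃ h₄
    have h₆ := locMap_locMap (Rep.functor ⋙ L) hQL (R ⋙ WN.Q) hRQ hQLR ψ
    dsimp only
    rw [locMap_comp, locMap_comp, locMap_map, reassoc_of% h₁, reassoc_of% h₂]
    erw [h₆]
    exact (Category.assoc _ _ _).symm.trans ((h₃.symm =≫ _).trans
      ((Category.assoc _ _ _).trans ((_ ≫= h₅).trans h₄)))

section

variable {F : A ⥤ B} {G : B ⥤ A} (adj : F ⊣ G) (hG : WB ≤ WA.inverseImage G)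

lemma isIso_Q_map_of_bijective {X Y : B} (f : WB.Q.obj X ⟶ WB.Q.obj Y)
    (hf : ∀ b, Function.Bijective (fun φ : WB.Q.obj Y ⟶ WB.Q.obj b => f ≫ φ)) : IsIso f := by
  obtain ⟨g, hg⟩ := (hf X).2 (𝟙 _)
  refine ⟨g, hg, (hf Y).1 ?_⟩
  dsimp at hg ⊢
  rw [reassoc_of% hg, Category.comp_id]

/-- Yoneda: `F.obj X` and `b₀` corepresent the same functor on the homotopy category, and the
adjoint of `f` is the comparison map. -/
lemma isIso_Q_map_homEquiv_symm {X : A} (hX : IsGood adj hG X) {b₀ : B} (f : X ⟶ G.obj b₀)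
    (hf : ∀ b, Function.Bijective (fun φ : WB.Q.obj b₀ ⟶ WB.Q.obj b =>
      WA.Q.map f ≫ locMap (G ⋙ WA.Q) (isInvertedBy_comp_Q hG) φ)) :
    IsIso (WB.Q.map ((adj.homEquiv X b₀).symm f)) := by
  refine isIso_Q_map_of_bijective _ fun b => ?_
  rw [← Function.Bijective.of_comp_iff' (hX b)]
  refine (congrArg Function.Bijective (funext fun φ => ?_)).mpr (hf b)
  dsimp only [Function.comp_apply]
  rw [locMap_comp, locMap_map, Functor.comp_map, ← Category.assoc]
  erw [← Functor.map_comp]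
  congr 2
  simp [Adjunction.homEquiv_counit]

lemma IsGood.isIso_Q_map {X X' : A} (hX : IsGood adj hG X) (hX' : IsGood adj hG X')
    (f : X ⟶ X') (hf : WA f) : IsIso (WB.Q.map (F.map f)) := by
  have := Localization.inverts WA.Q WA f hf
  have h := isIso_Q_map_homEquiv_symm adj hG hX (f ≫ adj.unit.app X') (fun b => by
    have e : Function.Bijective (fun φ : WA.Q.obj X' ⟶ WA.Q.obj (G.obj b) => WA.Q.map f ≫ φ) :=
      ⟨fun _ _ h => (cancel_epi _).1 h, fun g => ⟨inv (WA.Q.map f) ≫ g, by simp⟩⟩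
    refine (congrArg Function.Bijective (funext fun φ => ?_)).mpr (e.comp (hX' b))
    rw [Functor.map_comp]
    exact Category.assoc _ _ _)
  simpa [Adjunction.homEquiv_counit] using h

/-- The bijection for the composite adjunction factors through the two others, so two-out-of-three
for bijections applies. -/
lemma IsGood.of_comp {L : N ⥤ A} {R : A ⥤ N} (adj' : L ⊣ R) (hR : WA ≤ WN.inverseImage R)
    (hGR : WB ≤ WN.inverseImage (G ⋙ R)) {Y : N} (hY : IsGood adj' hR Y)
    (hY' : IsGood (adj'.comp adj) hGR Y) : IsGood adj hG (L.obj Y) := by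
  intro b
  rw [← Function.Bijective.of_comp_iff' (hY (G.obj b))]
  refine (congrArg Function.Bijective (funext fun φ => ?_)).mpr (hY' b)
  have h := locMap_locMap G (isInvertedBy_comp_Q hG) (R ⋙ WN.Q) (isInvertedBy_comp_Q hR)
    (isInvertedBy_comp_Q hGR) φ
  dsimp only [Function.comp_apply]
  rw [locMap_comp, locMap_map]
  erw [h]
  simp
  rfl

end

end Deformation

/-! ### Homotopy colimits over contractible index categories. -/

section Contraction

variable {N E : Type*} [Category* N] [Category* E] (W : MorphismProperty N)

lemma const_le : W ≤ (W.functorCategory E).inverseImage (Functor.const E) :=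
  fun _ _ _ hf _ => hf

lemma evaluation_le (e : E) : W.functorCategory E ≤ W.inverseImage ((evaluation E N).obj e) :=
  fun _ _ _ hf => hf e

lemma whiskeringLeft_le {E' : Type*} [Category* E'] (s : E' ⥤ E) :
    W.functorCategory E ≤
      (W.functorCategory E').inverseImage ((Functor.whiskeringLeft E' E N).obj s) :=
  fun _ _ _ hf x => hf (s.obj x)

variable {W} {T : E ⥤ N} {s : E ⥤ E} (a : 𝟭 E ⟶ s) {e : E} (b : (Functor.const E).obj e ⟶ s)

-- A map from `T` to a constant diagram is determined by its restriction along `s`, since `a`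
-- becomes invertible on constant diagrams. That restriction is determined by the value at `e`,
-- since `b` induces a weak equivalence from the constant diagram at `T.obj e`.
include a in
lemma hom_ext_of_contraction (hb : ∀ x, W (T.map (b.app x))) {B : N}
    {φ₁ φ₂ : (W.functorCategory E).Q.obj T ⟶ (W.functorCategory E).Q.obj ((Functor.const E).obj B)}
    (h : locMap ((evaluation E N).obj e ⋙ W.Q) (isInvertedBy_comp_Q (evaluation_le W e)) φ₁ =
      locMap ((evaluation E N).obj e ⋙ W.Q) (isInvertedBy_comp_Q (evaluation_le W e)) φ₂) :
    φ₁ = φ₂ := by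
  let WE := W.functorCategory E
  let S : (E ⥤ N) ⥤ (E ⥤ N) := (Functor.whiskeringLeft E E N).obj s
  have hS : WE.IsInvertedBy (S ⋙ WE.Q) := isInvertedBy_comp_Q (whiskeringLeft_le W s)
  have hc : WE.IsInvertedBy (((evaluation E N).obj e ⋙ Functor.const E) ⋙ WE.Q) :=
    isInvertedBy_comp_Q (fun _ _ _ hf _ => hf e)
  let a' : 𝟭 (E ⥤ N) ⟶ S := { app := fun U => Functor.whiskerRight a U }
  let b' : (evaluation E N).obj e ⋙ Functor.const E ⟶ S :=
    { app := fun U => { app := fun x => U.map (b.app x)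
                        naturality := fun x y f => by
                          have := b.naturality f
                          dsimp at this ⊢
                          rw [Category.id_comp] at this ⊢
                          rw [this]
                          exact U.map_comp _ _ } }
  have hab : locMap _ hc φ₁ = locMap _ hc φ₂ := by
    have := congrArg (locMap (Functor.const E ⋙ WE.Q) (isInvertedBy_comp_Q (const_le W))) h
    have h' := fun φ => locMap_locMap ((evaluation E N).obj e)
      (isInvertedBy_comp_Q (evaluation_le W e)) (Functor.const E ⋙ WE.Q)
      (isInvertedBy_comp_Q (const_le W)) hc (X := T) (Y := (Functor.const E).obj B) φ
    exact (h' φ₁).symm.trans (this.trans (h' φ₂))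
  have hS' : locMap _ hS φ₁ = locMap _ hS φ₂ := by
    have h₁ := locMap_naturality hc hS (Functor.whiskerRight b' WE.Q) φ₁
    have h₂ := locMap_naturality hc hS (Functor.whiskerRight b' WE.Q) φ₂
    have : IsIso (WE.Q.map (b'.app T)) := Localization.inverts WE.Q WE _ hb
    rw [← cancel_epi (WE.Q.map (b'.app T))]
    exact h₁.symm.trans ((hab =≫ _).trans h₂)
  have : IsIso (a'.app ((Functor.const E).obj B)) := by
    rw [NatTrans.isIso_iff_isIso_app]
    intro x
    dsimp [a']
    infer_instance
  rw [← cancel_mono (WE.Q.map (a'.app ((Functor.const E).obj B)))]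
  have h₁ := locMap_naturality (Localization.inverts WE.Q WE) hS (Functor.whiskerRight a' WE.Q) φ₁
  have h₂ := locMap_naturality (Localization.inverts WE.Q WE) hS (Functor.whiskerRight a' WE.Q) φ₂
  rw [locMap_Q] at h₁ h₂
  exact h₁.trans ((_ ≫= hS').trans h₂.symm)

-- A cocone whose leg at the base point is a weak equivalence thus has the universal property of the
-- homotopy colimit; the inverse bijection is evaluation at `e`.
include a in
theorem bijective_of_contraction (hb : ∀ x, W (T.map (b.app x))) (c : Cocone T)
    (hc : W (c.ι.app e)) (B : N) :
    Function.Bijective (fun ψ : W.Q.obj c.pt ⟶ W.Q.obj B => (W.functorCategory E).Q.map c.ι ≫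
      locMap (Functor.const E ⋙ (W.functorCategory E).Q) (isInvertedBy_comp_Q (const_le W)) ψ) := by
  have : IsIso (W.Q.map (c.ι.app e)) := Localization.inverts W.Q W _ hc
  have key : ∀ ψ : W.Q.obj c.pt ⟶ W.Q.obj B,
      locMap ((evaluation E N).obj e ⋙ W.Q) (isInvertedBy_comp_Q (evaluation_le W e))
        ((W.functorCategory E).Q.map c.ι ≫ locMap (Functor.const E ⋙ (W.functorCategory E).Q)
          (isInvertedBy_comp_Q (const_le W)) ψ) = W.Q.map (c.ι.app e) ≫ ψ := by
    intro ψ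
    rw [locMap_comp, locMap_map]
    erw [locMap_locMap (Functor.const E) _ _ _ (Localization.inverts W.Q W)]
    erw [locMap_Q]
    rfl
  refine ⟨fun ψ₁ ψ₂ h => ?_, fun φ => ⟨inv (W.Q.map (c.ι.app e)) ≫
    locMap ((evaluation E N).obj e ⋙ W.Q) (isInvertedBy_comp_Q (evaluation_le W e)) φ, ?_⟩⟩
  · have := congrArg (locMap ((evaluation E N).obj e ⋙ W.Q)
      (isInvertedBy_comp_Q (evaluation_le W e))) h
    dsimp only at this
    rw [key, key] at this
    exact (cancel_epi _).1 this
  · refine hom_ext_of_contraction a b hb ?_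
    dsimp only
    rw [key, IsIso.hom_inv_id_assoc]

end Contraction

/-! ### Left derived functors from deformations. -/

section Derived

variable {A E : Type*} [Category* A] [Category* E] {W : MorphismProperty A} (F : A ⥤ E)
  (Θ : A ⥤ A) (η : Θ ⟶ 𝟭 A)

theorem isLeftDerivedFunctor_of_deformation (hη : ∀ X, W (η.app X))
    (hF : W.IsInvertedBy (Θ ⋙ F)) (hF' : ∀ X, IsIso (F.map (η.app (Θ.obj X)))) :
    (Localization.lift (Θ ⋙ F) hF W.Q).IsLeftDerivedFunctor (F := F)
      ((Localization.fac (Θ ⋙ F) hF W.Q).hom ≫ Functor.whiskerRight η F) W := by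
  have hΘη : ∀ X, IsIso (F.map (Θ.map (η.app X))) := fun X => hF _ (hη X)
  have iη : ∀ X, IsIso (W.Q.map (η.app X)) := fun X => Localization.inverts W.Q W _ (hη X)
  constructor
  -- Naturality along the invertible `η.app X` transports the problem to `Θ.obj X`, where `α` can be
  -- used directly.
  let τ (G : W.Localization ⥤ E) (α : W.Q ⋙ G ⟶ F) : W.Q ⋙ G ⟶ Θ ⋙ F :=
    { app := fun X => inv (G.map (W.Q.map (η.app X))) ≫ α.app (Θ.obj X)
      naturality := fun X Y f => by
        have h₁ := η.naturality f
        have h₂ := α.naturality (Θ.map f)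
        dsimp at h₁ h₂ ⊢
        have h₃ := congrArg G.map (congrArg W.Q.map h₁)
        simp only [Functor.map_comp] at h₃
        rw [Category.assoc, ← h₂, ← cancel_epi (G.map (W.Q.map (η.app X))),
          IsIso.hom_inv_id_assoc, ← reassoc_of% h₃, IsIso.hom_inv_id_assoc] }
  let H := Localization.lift (Θ ⋙ F) hF W.Q
  let e : W.Q ⋙ H ≅ Θ ⋙ F := Localization.fac (Θ ⋙ F) hF W.Q
  have hext (G : W.Localization ⥤ E) (m m' : G ⟶ H)
      (h : Functor.whiskerLeft W.Q m ≫ e.hom ≫ Functor.whiskerRight η F =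
        Functor.whiskerLeft W.Q m' ≫ e.hom ≫ Functor.whiskerRight η F) : m = m' := by
    refine Localization.natTrans_ext W.Q W fun X => ?_
    have h₁ : m.app (W.Q.obj (Θ.obj X)) = m'.app (W.Q.obj (Θ.obj X)) := by
      have := NatTrans.congr_app h (Θ.obj X)
      dsimp at this
      rw [← Category.assoc, ← Category.assoc] at this
      exact (cancel_mono (e.hom.app (Θ.obj X))).1 ((cancel_mono (F.map (η.app (Θ.obj X)))).1 this)
    rw [← cancel_epi (G.map (W.Q.map (η.app X)))]
    erw [m.naturality, m'.naturality]
    dsimp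
    rw [h₁]
  have hlift (G : W.Localization ⥤ E) (α : W.Q ⋙ G ⟶ F) :
      ∃ m : G ⟶ H, Functor.whiskerLeft W.Q m ≫ e.hom ≫ Functor.whiskerRight η F = α := by
    refine ⟨Localization.liftNatTrans W.Q W (W.Q ⋙ G) (Θ ⋙ F) G H (τ G α), ?_⟩
    ext X
    have := α.naturality (η.app X)
    dsimp at this
    have he : (Localization.Lifting.iso W.Q W (Θ ⋙ F) H).inv.app X ≫ e.hom.app X = 𝟙 _ :=
      (Localization.Lifting.iso W.Q W (Θ ⋙ F) H).inv_hom_id_app X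
    simp [τ, reassoc_of% he, ← this]
  exact ⟨⟨IsTerminal.ofUniqueHom
    (fun G => CostructuredArrow.homMk (hlift G.left G.hom).choose
      (hlift G.left G.hom).choose_spec)
    fun G m => CostructuredArrow.hom_ext _ _ (hext G.left _ _
      ((CostructuredArrow.w m).trans (hlift G.left G.hom).choose_spec.symm))⟩⟩

end Derived

/-! ### Saturation of weak equivalences in model categories and their approximations. -/

section Saturation

variable {M : Type u₁} [Category.{v₁} M] [ModelCategory M]

/-- Lift the inverse to `M` and use covering homotopy to turn it into a strict section `s` of `p`.
Then `p ≫ s` is homotopic to the identity, hence a weak equivalence, and `p` is a retract of it. -/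
lemma weakEquivalence_of_isIso_map_of_fibration {D : Type*} [Category* D] (L : M ⥤ D)
    [L.IsLocalization (weakEquivalences M)] {X Y : M} [IsCofibrant X] [IsCofibrant Y]
    [IsFibrant X] [IsFibrant Y] (p : X ⟶ Y) [Fibration p] (hp : IsIso (L.map p)) :
    WeakEquivalence p := by
  obtain ⟨g, hg⟩ := map_surjective_of_isLocalization L Y X (inv (L.map p))
  have h₁ : LeftHomotopyRel (g ≫ p) (𝟙 Y) := by
    rw [LeftHomotopyRel.iff_map_eq L]
    simp [hg]
  obtain ⟨P, _, ⟨h⟩⟩ := h₁.exists_good_cylinder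
  obtain ⟨s, h', hs⟩ := h.covering_homotopy p g
  have hs' : s ≫ p = 𝟙 Y := by
    rw [← h'.h₁, Category.assoc, hs, h.h₁]
  have hs'' : L.map s = inv (L.map p) := by
    rw [← cancel_mono (L.map p)]
    simp [← L.map_comp, hs']
  have h₂ : LeftHomotopyRel (p ≫ s) (𝟙 X) := by
    rw [LeftHomotopyRel.iff_map_eq L]
    simp [hs'']
  obtain ⟨P', ⟨h₂⟩⟩ := h₂
  have : WeakEquivalence (p ≫ s) := by
    rw [Cylinder.LeftHomotopy.weakEquivalence_iff _ h₂]
    infer_instance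
  rw [weakEquivalence_iff] at this ⊢
  exact MorphismProperty.of_retract (P := weakEquivalences M)
    { i := Arrow.homMk (𝟙 X) s (by simp)
      r := Arrow.homMk (𝟙 X) p (by simp [hs'])
      retract := by ext <;> simp [hs'] } this

theorem weakEquivalence_of_isIso_map {D : Type*} [Category* D] (L : M ⥤ D)
    [L.IsLocalization (weakEquivalences M)] {X Y : M} (f : X ⟶ Y) (hf : IsIso (L.map f)) :
    WeakEquivalence f := by
  have hL : ∀ {A B : M} (g : A ⟶ B) [WeakEquivalence g], IsIso (L.map g) := fun g _ =>
    Localization.inverts L (weakEquivalences M) g ((weakEquivalence_iff g).1 inferInstance)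
  wlog hc : IsCofibrant X ∧ IsCofibrant Y generalizing X Y
  · have h := CofibrantObject.HoCat.resolutionMap_fac f
    have hL₁ := hL (CofibrantObject.HoCat.pResolutionObj X)
    have hL₂ := hL (CofibrantObject.HoCat.pResolutionObj Y)
    have h' : IsIso (L.map (CofibrantObject.HoCat.resolutionMap f)) := by
      have : L.map (CofibrantObject.HoCat.resolutionMap f) =
          L.map (CofibrantObject.HoCat.pResolutionObj X) ≫ L.map f ≫
            inv (L.map (CofibrantObject.HoCat.pResolutionObj Y)) := by
        rw [← Category.assoc, IsIso.eq_comp_inv, ← L.map_comp, ← L.map_comp, h]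
      rw [this]
      infer_instance
    have := this _ h' ⟨inferInstance, inferInstance⟩
    exact (CofibrantObject.HoCat.weakEquivalence_resolutionMap_iff f).1 this
  obtain ⟨_, _⟩ := hc
  wlog hc : IsFibrant X ∧ IsFibrant Y generalizing X Y
  · have h := FibrantObject.HoCat.resolutionMap_fac f
    have hL₁ := hL (FibrantObject.HoCat.iResolutionObj X)
    have hL₂ := hL (FibrantObject.HoCat.iResolutionObj Y)
    have h' : IsIso (L.map (FibrantObject.HoCat.resolutionMap f)) := by
      have : L.map (FibrantObject.HoCat.resolutionMap f) =
          inv (L.map (FibrantObject.HoCat.iResolutionObj X)) ≫ L.map f ≫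
            L.map (FibrantObject.HoCat.iResolutionObj Y) := by
        rw [IsIso.eq_inv_comp, ← L.map_comp, ← L.map_comp, h]
      rw [this]
      infer_instance
    have := this _ h' inferInstance inferInstance ⟨inferInstance, inferInstance⟩
    exact (FibrantObject.HoCat.weakEquivalence_resolutionMap_iff f).1 this
  obtain ⟨_, _⟩ := hc
  let d := MorphismProperty.factorizationData (trivialCofibrations M) (fibrations M) f
  have : IsFibrant d.Z := isFibrant_of_fibration d.p
  have : IsCofibrant d.Z := isCofibrant_of_cofibration d.i
  have h : IsIso (L.map d.p) := by
    have : L.map d.p = inv (L.map d.i) ≫ L.map f := by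
      rw [IsIso.eq_inv_comp, ← L.map_comp, d.fac]
    rw [this]
    infer_instance
  have := weakEquivalence_of_isIso_map_of_fibration L d.p h
  rw [← d.fac]
  infer_instance

/-- A class of weak equivalences is saturated if it contains all the morphisms which become
isomorphisms in the localization. -/
def IsSaturated {A : Type*} [Category* A] (W : MorphismProperty A) : Prop :=
  ∀ ⦃X Y : A⦄ (f : X ⟶ Y), IsIso (W.Q.map f) → W f

lemma isSaturated_weakEquivalences : IsSaturated (weakEquivalences M) := fun _ _ f hf =>
  (weakEquivalence_iff f).1 (weakEquivalence_of_isIso_map (weakEquivalences M).Q f hf)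

lemma IsSaturated.functorCategory {A : Type*} [Category* A] {W : MorphismProperty A}
    (hW : IsSaturated W) (K : Type*) [Category* K] : IsSaturated (W.functorCategory K) := by
  intro X Y f hf k
  refine hW _ ?_
  have : IsIso (locMap ((evaluation K A).obj k ⋙ W.Q)
      (isInvertedBy_comp_Q (evaluation_le W k)) ((W.functorCategory K).Q.map f)) := by
    rw [locMap]
    infer_instance
  rwa [locMap_map] at this

variable {C : Type u₂} [Category.{v₂} C] {W : MorphismProperty C}

/-- By saturation in `M`, `r.map f` is a weak equivalence; `l` of its cofibrant resolution is then
in `W`, and the adjoints of the two resolution maps compare it with `f`. -/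
lemma isSaturated_of_isLeftModelApproximation (hW : IsWeakEquivalenceClass W)
    {l : M ⥤ C} {r : C ⥤ M} (adj : l ⊣ r) (happrox : IsLeftModelApproximation W adj) :
    IsSaturated W := by
  have := hW.twoOutOfThree
  intro X Y f hf
  have hr : W ≤ (weakEquivalences M).inverseImage r := fun _ _ g hg =>
    (weakEquivalence_iff _).1 (happrox.map_right g hg)
  have h : IsIso (locMap (r ⋙ (weakEquivalences M).Q) (isInvertedBy_comp_Q hr) (W.Q.map f)) := by
    rw [locMap]
    infer_instance
  rw [locMap_map] at h
  have := weakEquivalence_of_isIso_map (weakEquivalences M).Q (r.map f) h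
  have cX : IsCofibrant (CofibrantObject.HoCat.resolutionObj (r.obj X)) := inferInstance
  have cY : IsCofibrant (CofibrantObject.HoCat.resolutionObj (r.obj Y)) := inferInstance
  have h₁ := happrox.adjoint (CofibrantObject.HoCat.pResolutionObj (r.obj X)) cX inferInstance
  have h₂ := happrox.adjoint (CofibrantObject.HoCat.pResolutionObj (r.obj Y)) cY inferInstance
  have h₃ := happrox.map_left (CofibrantObject.HoCat.resolutionMap (r.map f)) cX cY
    ((CofibrantObject.HoCat.weakEquivalence_resolutionMap_iff _).2 this)
  refine (W.precomp_iff _ _ h₁).1 ?_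
  rw [← Adjunction.homEquiv_naturality_right_symm, ← CofibrantObject.HoCat.resolutionMap_fac,
    Adjunction.homEquiv_naturality_left_symm]
  exact W.comp_mem _ _ h₃ h₂

end Saturation

/-! ### Direct categories and free diagrams on cells. -/

/-- A degree function on a category is direct if all the morphisms that do not raise the degree
are identities. -/
def IsDirect {D : Type*} [Category* D] (deg : D → ℕ) : Prop :=
  ∀ ⦃d e : D⦄ (f : d ⟶ e), deg e ≤ deg d → ∃ h : d = e, f = eqToHom h

section Cells

variable {M : Type u} [Category.{v} M] [HasColimitsOfSize.{w, w} M] {D : Type w} [Category.{w} D]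
  (deg : D → ℕ) (n : ℕ)

/-- The indexing type of the cells of degree `n` in the object `e`. -/
abbrev CellIndex (e : D) : Type w := Σ d : { d : D // deg d = n }, d.1 ⟶ e

variable {deg n} in
/-- The inclusion of a cell. -/
noncomputable def cellι (A : { d : D // deg d = n } → M) {e : D} (d : { d : D // deg d = n })
    (a : d.1 ⟶ e) : A d ⟶ ∐ fun x : CellIndex deg n e => A x.1 :=
  Sigma.ι (fun x : CellIndex deg n e => A x.1) ⟨d, a⟩

variable {deg n} in
/-- Morphisms out of a coproduct of cells. -/
noncomputable def cellDesc {A : { d : D // deg d = n } → M} {e : D} {Y : M}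
    (f : ∀ (d : { d : D // deg d = n }) (_ : d.1 ⟶ e), A d ⟶ Y) :
    (∐ fun x : CellIndex deg n e => A x.1) ⟶ Y :=
  Limits.Sigma.desc fun x => f x.1 x.2

@[simp]
lemma cellι_cellDesc {A : { d : D // deg d = n } → M} {e : D} {Y : M}
    (f : ∀ (d : { d : D // deg d = n }) (_ : d.1 ⟶ e), A d ⟶ Y) (d : { d : D // deg d = n })
    (a : d.1 ⟶ e) : cellι A d a ≫ cellDesc f = f d a :=
  Sigma.ι_desc _ _

@[simp]
lemma cellι_cellDesc_assoc {A : { d : D // deg d = n } → M} {e : D} {Y Z : M}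
    (f : ∀ (d : { d : D // deg d = n }) (_ : d.1 ⟶ e), A d ⟶ Y) (d : { d : D // deg d = n })
    (a : d.1 ⟶ e) (g : Y ⟶ Z) : cellι A d a ≫ cellDesc f ≫ g = f d a ≫ g := by
  rw [← Category.assoc, cellι_cellDesc]

lemma cell_hom_ext {A : { d : D // deg d = n } → M} {e : D} {Y : M}
    {f g : (∐ fun x : CellIndex deg n e => A x.1) ⟶ Y}
    (h : ∀ d (a : d.1 ⟶ e), cellι A d a ≫ f = cellι A d a ≫ g) : f = g :=
  Sigma.hom_ext _ _ fun x => h x.1 x.2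

/-- The free diagram generated by a family of objects sitting at the objects of degree `n`. -/
noncomputable def cellsObj (A : { d : D // deg d = n } → M) : D ⥤ M where
  obj e := ∐ fun x : CellIndex deg n e => A x.1
  map f := cellDesc fun d a => cellι A d (a ≫ f)
  map_id e := cell_hom_ext _ _ (by simp)
  map_comp f g := cell_hom_ext _ _ (by simp)

variable {deg n} in
/-- The inclusion of a cell in the free diagram. -/
noncomputable def cellsι (A : { d : D // deg d = n } → M) {e : D} (d : { d : D // deg d = n })
    (a : d.1 ⟶ e) : A d ⟶ (cellsObj deg n A).obj e :=
  cellι A d a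

variable {deg n} in
/-- Morphisms out of the values of the free diagram. -/
noncomputable def cellsDesc {A : { d : D // deg d = n } → M} {e : D} {Y : M}
    (f : ∀ (d : { d : D // deg d = n }) (_ : d.1 ⟶ e), A d ⟶ Y) :
    (cellsObj deg n A).obj e ⟶ Y :=
  cellDesc f

@[simp]
lemma cellsι_cellsDesc {A : { d : D // deg d = n } → M} {e : D} {Y : M}
    (f : ∀ (d : { d : D // deg d = n }) (_ : d.1 ⟶ e), A d ⟶ Y) (d : { d : D // deg d = n })
    (a : d.1 ⟶ e) : cellsι A d a ≫ cellsDesc f = f d a :=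
  cellι_cellDesc _ _ _ _ _

@[simp]
lemma cellsι_cellsDesc_assoc {A : { d : D // deg d = n } → M} {e : D} {Y Z : M}
    (f : ∀ (d : { d : D // deg d = n }) (_ : d.1 ⟶ e), A d ⟶ Y) (d : { d : D // deg d = n })
    (a : d.1 ⟶ e) (g : Y ⟶ Z) : cellsι A d a ≫ cellsDesc f ≫ g = f d a ≫ g := by
  rw [← Category.assoc, cellsι_cellsDesc]

@[simp]
lemma cellsι_map (A : { d : D // deg d = n } → M) {e e' : D} (d : { d : D // deg d = n })
    (a : d.1 ⟶ e) (f : e ⟶ e') :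
    cellsι A d a ≫ (cellsObj deg n A).map f = cellsι A d (a ≫ f) :=
  cellι_cellDesc deg n (fun d a => cellι A d (a ≫ f)) d a

@[simp]
lemma cellsι_map_assoc (A : { d : D // deg d = n } → M) {e e' : D} (d : { d : D // deg d = n })
    (a : d.1 ⟶ e) (f : e ⟶ e') {Z : M} (g : (cellsObj deg n A).obj e' ⟶ Z) :
    cellsι A d a ≫ (cellsObj deg n A).map f ≫ g = cellsι A d (a ≫ f) ≫ g := by
  rw [← Category.assoc, cellsι_map]

lemma cellsObj_hom_ext {A : { d : D // deg d = n } → M} {e : D} {Y : M}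
    {f g : (cellsObj deg n A).obj e ⟶ Y}
    (h : ∀ d (a : d.1 ⟶ e), cellsι A d a ≫ f = cellsι A d a ≫ g) : f = g :=
  cell_hom_ext _ _ h

variable {deg n} in
/-- Morphisms out of free diagrams. -/
noncomputable def cellsHom {A : { d : D // deg d = n } → M} {Y : D ⥤ M}
    (g : ∀ d : { d : D // deg d = n }, A d ⟶ Y.obj d.1) : cellsObj deg n A ⟶ Y where
  app e := cellsDesc fun d a => g d ≫ Y.map a
  naturality e e' a := cellsObj_hom_ext _ _ fun d a => by simp

lemma cellsι_cellsHom {A : { d : D // deg d = n } → M} {Y : D ⥤ M}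
    (g : ∀ d : { d : D // deg d = n }, A d ⟶ Y.obj d.1) (d : { d : D // deg d = n }) :
    cellsι A d (𝟙 d.1) ≫ (cellsHom g).app d.1 = g d := by
  simp [cellsHom]

lemma cellsHom_cellsι {A : { d : D // deg d = n } → M} {Y : D ⥤ M} (f : cellsObj deg n A ⟶ Y) :
    cellsHom (fun d => cellsι A d (𝟙 d.1) ≫ f.app d.1) = f := by
  ext e
  refine cellsObj_hom_ext _ _ fun d a => ?_
  simp only [cellsHom]
  rw [cellsι_cellsDesc, Category.assoc, ← f.naturality, cellsι_map_assoc, Category.id_comp]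

/-- The restriction to the objects of degree `n`. -/
def restrictDegree : (D ⥤ M) ⥤ ({ d : D // deg d = n } → M) where
  obj Y d := Y.obj d.1
  map f d := f.app d.1

/-- The universal property of free diagrams. -/
noncomputable def cellsHomEquiv (A : { d : D // deg d = n } → M) (Y : D ⥤ M) :
    (cellsObj deg n A ⟶ Y) ≃ (A ⟶ (restrictDegree deg n).obj Y) where
  toFun f d := cellsι A d (𝟙 d.1) ≫ f.app d.1
  invFun g := cellsHom g
  left_inv := cellsHom_cellsι deg n
  right_inv g := funext (cellsι_cellsHom deg n g)

/-- The free diagram functor, left adjoint of the restriction to the objects of degree `n`. -/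
noncomputable def cells : ({ d : D // deg d = n } → M) ⥤ D ⥤ M :=
  Adjunction.leftAdjointOfEquiv (cellsHomEquiv deg n) fun A Y Y' f g => by
    funext d
    exact (Category.assoc _ _ _).symm

/-- The adjunction between free diagrams and restriction to the objects of degree `n`. -/
noncomputable def cellsAdj : cells (M := M) (D := D) deg n ⊣ restrictDegree deg n :=
  Adjunction.adjunctionOfEquivLeft (cellsHomEquiv deg n) _

variable {deg n}

lemma cellsι_homEquiv_symm_app {A : { d : D // deg d = n } → M} {Y : D ⥤ M}
    (f : A ⟶ (restrictDegree deg n).obj Y) (d : { d : D // deg d = n }) :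
    cellsι A d (𝟙 d.1) ≫ (((cellsAdj deg n).homEquiv A Y).symm f).app d.1 = f d := by
  have h : (cellsAdj deg n).homEquiv A Y = cellsHomEquiv deg n A Y :=
    congrFun (congrFun (Adjunction.mkOfHomEquiv_homEquiv _) A) Y
  rw [h]
  exact congrFun ((cellsHomEquiv deg n A Y).apply_symm_apply f) d

/-- Directness forbids morphisms from degree `n` to a lower degree, so both free diagrams are
initial at `e`. -/
lemma isIso_cells_map_app (hdeg : IsDirect deg) {A B : { d : D // deg d = n } → M} (a : A ⟶ B)
    {e : D} (he : deg e < n) : IsIso (((cells deg n).map a).app e) := by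
  have : ∀ (d : { d : D // deg d = n }), IsEmpty (d.1 ⟶ e) := fun ⟨d, hd⟩ => ⟨fun f => by
    obtain ⟨rfl, -⟩ := hdeg f (by dsimp; omega)
    exact he.ne hd⟩
  have hA : ∀ A : { d : D // deg d = n } → M, IsInitial (((cells deg n).obj A).obj e) := fun A =>
    IsInitial.ofUniqueHom (fun Y => cellsDesc fun d a => isEmptyElim a)
      (fun Y m => cellsObj_hom_ext _ _ fun d a => isEmptyElim a)
  exact ⟨(hA B).to _, (hA A).hom_ext _ _, (hA B).hom_ext _ _⟩

/-- The only morphisms between objects of degree `n` are identities, so the coproduct has one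
summand. -/
lemma isIso_cellsι (hdeg : IsDirect deg) (A : { d : D // deg d = n } → M)
    (d : { d : D // deg d = n }) : IsIso (cellsι A d (𝟙 d.1)) := by
  have h : ∀ (d' : { d : D // deg d = n }) (f : d'.1 ⟶ d.1),
      ∃ h : d' = d, f = eqToHom (by rw [h]) := by
    rintro ⟨d', hd'⟩ f
    obtain ⟨d, hd⟩ := d
    obtain ⟨h, rfl⟩ := hdeg f (by dsimp; omega)
    exact ⟨Subtype.ext h, rfl⟩
  refine ⟨cellsDesc fun d' f => eqToHom (by rw [(h d' f).1]), ?_,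
    cellsObj_hom_ext _ _ fun d' f => ?_⟩
  · rw [cellsι_cellsDesc]
    simp
  · obtain ⟨rfl, rfl⟩ := h d' f
    rw [cellsι_cellsDesc_assoc]
    simp

lemma cells_homEquiv_symm_app_mem (hdeg : IsDirect deg) (B : MorphismProperty M) [B.RespectsIso]
    {A : { d : D // deg d = n } → M} {Y : D ⥤ M} (f : A ⟶ (restrictDegree deg n).obj Y)
    (d : { d : D // deg d = n }) (hf : B (f d)) :
    B ((((cellsAdj deg n).homEquiv A Y).symm f).app d.1) := by
  have h : B (cellsι A d (𝟙 d.1) ≫ (((cellsAdj deg n).homEquiv A Y).symm f).app d.1) := by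
    rw [cellsι_homEquiv_symm_app]
    exact hf
  have : IsIso (Y := ((cells deg n).obj A).obj d.1) (cellsι A d (𝟙 d.1)) := isIso_cellsι hdeg A d
  exact (B.cancel_left_of_respectsIso (Y := ((cells deg n).obj A).obj d.1)
    (cellsι A d (𝟙 d.1)) _).1 h

lemma cells_map_mem_llp {T : MorphismProperty M} {A B : { d : D // deg d = n } → M} (a : A ⟶ B)
    (ha : ∀ d, T.llp (a d)) : (T.functorCategory D).llp ((cells deg n).map a) := by
  intro X Y p hp
  rw [(cellsAdj deg n).hasLiftingProperty_iff]
  constructor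
  intro f g sq
  have sq' : ∀ d, CommSq (f d) (a d) (p.app d.1) (g d) := fun d => ⟨congrFun sq.w d⟩
  have hl := fun d => ((ha d _ (hp d.1)).sq_hasLift (sq' d)).exists_lift
  exact ⟨⟨{ l := fun d => (hl d).some.l
            fac_left := funext fun d => (hl d).some.fac_left
            fac_right := funext fun d => (hl d).some.fac_right }⟩⟩

end Cells

/-! ### Factorizations of diagrams by induction on the degree. -/

section Factorization

variable {M : Type u} [Category.{v} M] [HasColimitsOfSize.{w, w} M] [HasPushouts M]
  {D : Type w} [Category.{w} D]
  {deg : D → ℕ} {S : Type*} [Category* S] {P B T : MorphismProperty M}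
  [B.RespectsIso]
  [MorphismProperty.HasFactorization (P.functorCategory S) (B.functorCategory S)]

/-- One step in the construction of factorizations by induction on the degree. -/
lemma exists_factorization_step (hdeg : IsDirect deg) (hP : P ≤ T.llp) (n : ℕ)
    {X : S ⥤ D ⥤ M} (U : Over X) :
    ∃ (V : Over X) (j : U ⟶ V), ((T.functorCategory D).llp.functorCategory S) j.left ∧
      (∀ s e, deg e < n → IsIso ((j.left.app s).app e)) ∧
      (∀ s e, deg e = n → B ((V.hom.app s).app e)) := by
  -- Factoring in `S ⥤ M` keeps the construction functorial in the parameter `S`.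
  let d (d : { d : D // deg d = n }) := MorphismProperty.factorizationData
    (P.functorCategory S) (B.functorCategory S)
    (((Functor.whiskeringRight S _ _).obj ((evaluation D M).obj d.1)).map U.hom)
  let Z : S ⥤ ({ d : D // deg d = n } → M) := Functor.pi' fun x => (d x).Z
  let α : U.left ⋙ restrictDegree deg n ⟶ Z :=
    { app := fun s x => (d x).i.app s
      naturality := fun s s' f => by
        funext x
        exact (d x).i.naturality f }
  let β : Z ⟶ X ⋙ restrictDegree deg n :=
    { app := fun s x => (d x).p.app s
      naturality := fun s s' f => by
        funext x
        exact (d x).p.naturality f }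
  have hαβ : α ≫ β = Functor.whiskerRight U.hom (restrictDegree deg n) := by
    ext s x
    exact NatTrans.congr_app (d x).fac s
  let c := (cellsAdj (M := M) deg n).counit
  let top : (U.left ⋙ restrictDegree deg n) ⋙ cells deg n ⟶ U.left := Functor.whiskerLeft U.left c
  let left : (U.left ⋙ restrictDegree deg n) ⋙ cells deg n ⟶ Z ⋙ cells deg n :=
    Functor.whiskerRight α _
  let q : Z ⋙ cells deg n ⟶ X := Functor.whiskerRight β (cells deg n) ≫ Functor.whiskerLeft X c
  have hq : top ≫ U.hom = left ≫ q := by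
    rw [← Category.assoc, ← Functor.whiskerRight_comp, hαβ]
    ext s : 2
    exact (c.naturality (U.hom.app s)).symm
  have sq := IsPushout.of_hasPushout top left
  refine ⟨Over.mk (sq.desc U.hom q hq), Over.homMk (pushout.inl top left) (sq.inl_desc _ _ _),
    ?_, ?_, ?_⟩
  · have h : ((T.functorCategory D).llp.functorCategory S) left := fun s =>
      cells_map_mem_llp (α.app s) fun x => hP _ ((d x).hi s)
    change ((T.functorCategory D).llp.functorCategory S) (pushout.inl top left)
    exact MorphismProperty.of_isPushout sq h
  · intro s e he
    have sq' := sq.map ((evaluation S _).obj s ⋙ (evaluation D M).obj e)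
    have : IsIso (((evaluation S _).obj s ⋙ (evaluation D M).obj e).map left) :=
      isIso_cells_map_app hdeg _ he
    exact sq'.isIso_inl_of_isIso
  · intro s e he
    have sq' := sq.map ((evaluation S _).obj s ⋙ (evaluation D M).obj e)
    -- In degree `n` the attaching map is invertible, so there the pushout is exactly the middle
    -- object of the chosen factorization.
    have h : IsIso (((evaluation S _).obj s ⋙ (evaluation D M).obj e).map top) := by
      have := cells_homEquiv_symm_app_mem hdeg (MorphismProperty.isomorphisms M)
        (𝟙 ((restrictDegree deg n).obj (U.left.obj s))) ⟨e, he⟩ (by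
          change IsIso (𝟙 _)
          infer_instance)
      rw [Adjunction.homEquiv_counit, CategoryTheory.Functor.map_id, Category.id_comp] at this
      exact this
    have h₂ : IsIso (((pushout.inr top left).app s).app e) := sq'.isIso_inr_of_isIso
    have h₃ : B ((q.app s).app e) := by
      have := cells_homEquiv_symm_app_mem hdeg B (β.app s) ⟨e, he⟩ ((d ⟨e, he⟩).hp s)
      rw [Adjunction.homEquiv_counit] at this
      exact this
    have h₄ := NatTrans.congr_app (NatTrans.congr_app (sq.inr_desc U.hom q hq) s) e
    rw [← h₄] at h₃
    exact (B.cancel_left_of_respectsIso _ _).1 h₃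

-- Stage `n` repairs degree `n` without disturbing lower degrees. The left map is the resulting
-- sequential composite of maps in `(T.functorCategory D).llp`; the right map can be checked at a
-- finite stage.
variable (S) in
theorem exists_factorization (hdeg : IsDirect deg) (hP : P ≤ T.llp) {Y X : S ⥤ D ⥤ M}
    (f : Y ⟶ X) : ∃ (Z : S ⥤ D ⥤ M) (i : Y ⟶ Z) (p : Z ⟶ X), i ≫ p = f ∧
      (∀ s, (T.functorCategory D).llp (i.app s)) ∧ ∀ s e, B ((p.app s).app e) := by
  choose V j h₁ h₂ h₃ using exists_factorization_step (T := T) (B := B) (S := S) (X := X) hdeg hP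
  let U : ℕ → Over X := fun n => n.rec (Over.mk f) V
  let F : ℕ ⥤ Over X := Functor.ofSequence (X := U) fun n => j n (U n)
  have : HasColimitsOfShape ℕ M := by
    have := hasColimitsOfSizeShrink.{0, 0, w, w} M
    infer_instance
  let c : Cocone (F ⋙ Over.forget X) := ⟨X, { app := fun n => (F.obj n).hom }⟩
  let cl := colimit.cocone (F ⋙ Over.forget X)
  let hcl : IsColimit cl := colimit.isColimit _
  refine ⟨cl.pt, cl.ι.app 0, hcl.desc c, hcl.fac c 0, ?_, ?_⟩
  · intro s
    let ev := (evaluation S (D ⥤ M)).obj s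
    let t : (T.functorCategory D).llp.TransfiniteCompositionOfShape ℕ ((cl.ι.app 0).app s) :=
      { F := (F ⋙ Over.forget X) ⋙ ev
        isoBot := Iso.refl _
        incl := (ev.mapCocone cl).ι
        isColimit := isColimitOfPreserves ev hcl
        fac := Category.id_comp _
        map_mem := fun n _ => by
          have : F.map (homOfLE (Order.le_succ n)) = j n (U n) :=
            Functor.ofSequence_map_homOfLE_succ _ n
          rw [Functor.comp_map, Functor.comp_map, this]
          exact h₁ n (U n) s }
    exact MorphismProperty.transfiniteCompositionsOfShape_le _ _ _ t.mem
  · intro s e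
    let ev := (evaluation S _).obj s ⋙ (evaluation D M).obj e
    let G := (F ⋙ Over.forget X) ⋙ ev
    -- The step that treats `deg e` produces the object of index `deg e + 1`; all later maps are
    -- isomorphisms at `e`.
    have hG : G.IsEventuallyConstantFrom (deg e + 1) := by
      have : ∀ n k (h : deg e < n), IsIso (G.map (homOfLE (Nat.le_add_right n k))) := by
        intro n k h
        induction k with
        | zero =>
          have : homOfLE (Nat.le_add_right n 0) = 𝟙 n := rfl
          rw [this, G.map_id]
          infer_instance
        | succ k ih =>
          have h'' : homOfLE (Nat.le_add_right n (k + 1)) = homOfLE (Nat.le_add_right n k) ≫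
            homOfLE (Nat.le_add_right (n + k) 1) := rfl
          have h' : F.map (homOfLE (Nat.le_add_right (n + k) 1)) = j (n + k) (U (n + k)) :=
            Functor.ofSequence_map_homOfLE_succ _ _
          have : IsIso (G.map (homOfLE (Nat.le_add_right (n + k) 1))) := by
            dsimp only [G, Functor.comp_map]
            rw [h']
            exact h₂ (n + k) (U (n + k)) s e (by omega)
          rw [h'', G.map_comp]
          infer_instance
      intro n φ
      obtain ⟨k, rfl⟩ := Nat.exists_eq_add_of_le (leOfHom φ)
      exact this _ k (by omega)
    have hi : IsIso (((cl.ι.app (deg e + 1)).app s).app e) :=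
      hG.isIso_ι_of_isColimit (isColimitOfPreserves ev hcl)
    have h := h₃ (deg e) (U (deg e)) s e rfl
    have h₄ : (cl.ι.app (deg e + 1)) ≫ hcl.desc c = (V (deg e) (U (deg e))).hom :=
      hcl.fac c (deg e + 1)
    rw [← h₄] at h
    exact (B.cancel_left_of_respectsIso ((cl.ι.app (deg e + 1)).app s |>.app e) _).1 h

end Factorization

instance {A : Type*} [Category* A] (W : MorphismProperty A) [W.HasTwoOutOfThreeProperty]
    (K : Type*) [Category* K] : (W.functorCategory K).HasTwoOutOfThreeProperty where
  comp_mem _ _ hf hg k := W.comp_mem _ _ (hf k) (hg k)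
  of_postcomp f g hg hfg k := W.of_postcomp (f.app k) (g.app k) (hg k) (hfg k)
  of_precomp f g hf hfg k := W.of_precomp (f.app k) (g.app k) (hf k) (hfg k)

/-! ### Projective objects and lifting properties under adjunctions. -/

section Projective

variable {A B : Type*} [Category* A] [Category* B]

/-- An object is projective relatively to a class of morphisms if all morphisms out of it lift
along the morphisms in this class. -/
def IsProjectiveFor (T : MorphismProperty A) : ObjectProperty A := fun Y =>
  ∀ ⦃U V : A⦄ (p : U ⟶ V), T p → ∀ g : Y ⟶ V, ∃ h, h ≫ p = g

lemma IsProjectiveFor.map_of_adjunction {T : MorphismProperty A} {T' : MorphismProperty B}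
    {F : A ⥤ B} {G : B ⥤ A} (adj : F ⊣ G) (hG : T' ≤ T.inverseImage G) {Y : A}
    (hY : IsProjectiveFor T Y) : IsProjectiveFor T' (F.obj Y) := by
  intro U V p hp g
  obtain ⟨h, hh⟩ := hY _ (hG _ hp) (adj.homEquiv _ _ g)
  exact ⟨(adj.homEquiv _ _).symm h, by
    rw [← Adjunction.homEquiv_naturality_right_symm, hh, Equiv.symm_apply_apply]⟩

lemma IsProjectiveFor.of_llp {T : MorphismProperty A} {X Y : A} (i : X ⟶ Y) (hi : T.llp i)
    (hX : IsInitial X) : IsProjectiveFor T Y := by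
  intro U V p hp g
  have sq : CommSq (hX.to U) i p g := ⟨hX.hom_ext _ _⟩
  have := hi p hp
  exact ⟨sq.lift, sq.fac_right⟩

lemma IsProjectiveFor.llp {T : MorphismProperty A} {X Y : A} (i : X ⟶ Y)
    (hX : IsInitial X) (hY : IsProjectiveFor T Y) : T.llp i := by
  intro U V p hp
  constructor
  intro f g _
  obtain ⟨h, hh⟩ := hY p hp g
  exact ⟨⟨{ l := h, fac_left := hX.hom_ext _ _, fac_right := hh }⟩⟩

lemma IsProjectiveFor.llp_inl {T : MorphismProperty A} [HasBinaryCoproducts A] (X : A) {Y : A}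
    (hY : IsProjectiveFor T Y) : T.llp (coprod.inl : X ⟶ X ⨿ Y) := by
  intro U V p hp
  constructor
  intro f g sq
  obtain ⟨h, hh⟩ := hY p hp (coprod.inr ≫ g)
  exact ⟨⟨{ l := coprod.desc f h
            fac_left := coprod.inl_desc _ _
            fac_right := coprod.hom_ext
              (by rw [coprod.inl_desc_assoc]; exact sq.w)
              (by rw [coprod.inr_desc_assoc]; exact hh) }⟩⟩

lemma IsProjectiveFor.llp_inr {T : MorphismProperty A} [HasBinaryCoproducts A] {X : A} (Y : A)
    (hX : IsProjectiveFor T X) : T.llp (coprod.inr : Y ⟶ X ⨿ Y) := by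
  intro U V p hp
  constructor
  intro f g sq
  obtain ⟨h, hh⟩ := hX p hp (coprod.inl ≫ g)
  exact ⟨⟨{ l := coprod.desc h f
            fac_left := coprod.inr_desc _ _
            fac_right := coprod.hom_ext
              (by rw [coprod.inl_desc_assoc]; exact hh)
              (by rw [coprod.inr_desc_assoc]; exact sq.w) }⟩⟩

lemma llp_map_of_adjunction {T : MorphismProperty A} {T' : MorphismProperty B}
    {F : A ⥤ B} {G : B ⥤ A} (adj : F ⊣ G) (hG : T' ≤ T.inverseImage G) {X Y : A} (i : X ⟶ Y)
    (hi : T.llp i) : T'.llp (F.map i) := fun _ _ p hp => by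
  rw [adj.hasLiftingProperty_iff]
  exact hi _ (hG _ hp)

/-- The right adjoint of evaluation is a product over a hom-set at each object. -/
lemma evaluationRightAdjoint_le (T : MorphismProperty A) {K : Type w} [Category.{w} K]
    [∀ J : Type w, T.IsStableUnderProductsOfShape J] [HasProducts.{w} A] (k : K) :
    T ≤ (T.functorCategory K).inverseImage (evaluationRightAdjoint A k) := by
  intro X Y f hf k'
  exact MorphismProperty.limMap (W := T) (X := Discrete.functor fun _ : k' ⟶ k => X)
    (Y := Discrete.functor fun _ : k' ⟶ k => Y) (Discrete.natTrans (fun _ => f)) (fun _ => hf)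

end Projective

lemma isCofibrant_iff_isProjectiveFor {M : Type*} [Category* M] [ModelCategory M] (X : M) :
    IsCofibrant X ↔ IsProjectiveFor (trivialFibrations M) X := by
  rw [isCofibrant_iff, cofibration_iff, ← trivialFibrations_llp]
  exact ⟨fun h => .of_llp _ h initialIsInitial, fun h => h.llp _ initialIsInitial⟩

section

instance {M : Type*} [Category* M] {P B : MorphismProperty M} [P.HasFactorization B] :
    (P.functorCategory (Discrete PUnit.{1})).HasFactorization
      (B.functorCategory (Discrete PUnit.{1})) where
  nonempty_mapFactorizationData {F G} f := by
    let d := fun s => MorphismProperty.factorizationData P B (f.app s)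
    refine ⟨{ Z := Discrete.functor fun s => (d ⟨s⟩).Z
              i := Discrete.natTrans fun s => (d s).i
              p := Discrete.natTrans fun s => (d s).p
              fac := ?_
              hi := fun s => (d s).hi
              hp := fun s => (d s).hp }⟩
    ext s
    exact (d s).fac

end

lemma llp_app {M : Type u₁} [Category.{v₁} M] [HasLimitsOfSize.{w, w} M] {D : Type w}
    [Category.{w} D] {T : MorphismProperty M}
    [∀ J : Type w, T.IsStableUnderProductsOfShape J] {X Y : D ⥤ M} (i : X ⟶ Y)
    (hi : (T.functorCategory D).llp i) (d : D) : T.llp (i.app d) :=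
  llp_map_of_adjunction (evaluationAdjunctionLeft M d) (evaluationRightAdjoint_le T d) i hi

/-! ### Projective homotopy theory of diagrams on a direct category. -/

section Direct

variable {M : Type u₁} [Category.{v₁} M] [ModelCategory M] [HasColimitsOfSize.{w, w} M]
  {D : Type w} [Category.{w} D] {deg : D → ℕ}

lemma exists_objectwise_factorization {P B : MorphismProperty M} [B.RespectsIso]
    [P.HasFactorization B] {T : MorphismProperty M} (hdeg : IsDirect deg) (hP : P ≤ T.llp)
    {X Y : D ⥤ M} (f : X ⟶ Y) : ∃ (Z : D ⥤ M) (i : X ⟶ Z) (p : Z ⟶ Y), i ≫ p = f ∧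
      (T.functorCategory D).llp i ∧ B.functorCategory D p := by
  obtain ⟨Z, i, p, fac, hi, hp⟩ := exists_factorization (S := Discrete PUnit.{1}) (P := P) (B := B)
    hdeg hP (Functor.whiskerLeft ((Functor.const (Discrete PUnit.{1})).obj (Discrete.mk PUnit.unit))
      (Discrete.natTrans (F := (Functor.const (Discrete PUnit.{1})).obj X)
        (G := (Functor.const (Discrete PUnit.{1})).obj Y) (fun _ => f)))
  exact ⟨Z.obj ⟨⟨⟩⟩, i.app ⟨⟨⟩⟩, p.app ⟨⟨⟩⟩, NatTrans.congr_app fac ⟨⟨⟩⟩, hi _, hp _⟩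

/-- Taking `D ⥤ M` itself as the parameter category and factoring initial object to identity
resolves all diagrams simultaneously, hence functorially. -/
lemma nonempty_replacement (hdeg : IsDirect deg)
    [MorphismProperty.HasFunctorialFactorization (cofibrations M) (trivialFibrations M)] :
    Nonempty (Replacement ((weakEquivalences M).functorCategory D)
      (IsProjectiveFor ((trivialFibrations M).functorCategory D))) := by
  obtain ⟨Z, i, p, -, hi, hp⟩ := exists_factorization (S := D ⥤ M) (P := cofibrations M)
    (B := trivialFibrations M) (T := trivialFibrations M) hdeg (trivialFibrations_llp M).ge
    (Y := (Functor.const _).obj (⊥_ (D ⥤ M))) (X := 𝟭 (D ⥤ M))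
    { app := fun X => initial.to X }
  exact ⟨{ functor := Z
           hom := p
           hom_mem := fun X d => (hp X d).2
           obj_mem := fun X => .of_llp (i.app X) (hi X) initialIsInitial }⟩

/-- Retract argument: in a factorization through a map lifting against objectwise fibrations, the
second factor is an objectwise trivial fibration, against which `i` lifts. -/
lemma llp_fibrations_of_weakEquivalence [HasLimitsOfSize.{w, w} M] (hdeg : IsDirect deg)
    {X Y : D ⥤ M} (i : X ⟶ Y) (hi : ((trivialFibrations M).functorCategory D).llp i)
    (hi' : (weakEquivalences M).functorCategory D i) :
    ((fibrations M).functorCategory D).llp i := by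
  obtain ⟨Z, j, p, fac, hj, hp⟩ := exists_objectwise_factorization (P := trivialCofibrations M)
    (B := fibrations M) (T := fibrations M) hdeg (fibrations_llp M).ge i
  have hp' : (trivialFibrations M).functorCategory D p := fun d => by
    have h₁ := llp_app j hj d
    rw [fibrations_llp] at h₁
    refine ⟨hp d, ((weakEquivalences M).precomp_iff (j.app d) _ h₁.2).1 ?_⟩
    rw [← NatTrans.comp_app, fac]
    exact hi' d
  have := hi p hp'
  exact MorphismProperty.of_retract (RetractArrow.ofLeftLiftingProperty fac) hj

/-- Ken Brown's lemma for the projective model structure on diagrams indexed by a direct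
category. -/
theorem preservesWeakBetween_of_adjunction [HasLimitsOfSize.{w, w} M] (hdeg : IsDirect deg)
    {L : (D ⥤ M) ⥤ M} {R : M ⥤ D ⥤ M} (adj : L ⊣ R)
    (hR : fibrations M ≤ ((fibrations M).functorCategory D).inverseImage R) :
    PreservesWeakBetween ((weakEquivalences M).functorCategory D)
      (IsProjectiveFor ((trivialFibrations M).functorCategory D)) (weakEquivalences M) L := by
  intro X Y f hX hY hf
  have key : ∀ {A B : D ⥤ M} (i : A ⟶ B) (_ : ((trivialFibrations M).functorCategory D).llp i)
      (_ : (weakEquivalences M).functorCategory D i), weakEquivalences M (L.map i) := by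
    intro A B i hi hi'
    have := llp_map_of_adjunction adj hR i (llp_fibrations_of_weakEquivalence hdeg i hi hi')
    rw [fibrations_llp] at this
    exact this.2
  -- Brown's factorization: `L` inverts both coprojections followed by `i`, and `p` is a retraction
  -- of the second one.
  obtain ⟨Z, i, p, fac, hi, hp⟩ := exists_objectwise_factorization (P := cofibrations M)
    (B := trivialFibrations M) (T := trivialFibrations M) hdeg (trivialFibrations_llp M).ge
    (coprod.desc f (𝟙 Y))
  have hp' : (weakEquivalences M).functorCategory D p := fun d => (hp d).2
  have h₁ : (coprod.inl ≫ i) ≫ p = f := by rw [Category.assoc, fac, coprod.inl_desc]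
  have h₂ : (coprod.inr ≫ i) ≫ p = 𝟙 Y := by rw [Category.assoc, fac, coprod.inr_desc]
  have k₁ := key (coprod.inl ≫ i) (MorphismProperty.comp_mem _ _ _ (hY.llp_inl X) hi)
    (MorphismProperty.of_postcomp _ _ p hp' (by rwa [h₁]))
  have k₂ := key (coprod.inr ≫ i) (MorphismProperty.comp_mem _ _ _ (hX.llp_inr Y) hi)
    (MorphismProperty.of_postcomp _ _ p hp' (by
      rw [h₂]
      exact fun d => MorphismProperty.id_mem _ _))
  have k₃ : weakEquivalences M (L.map p) := by
    refine MorphismProperty.of_precomp _ _ _ k₂ ?_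
    rw [← L.map_comp, h₂, L.map_id]
    exact MorphismProperty.id_mem _ _
  rw [← h₁, L.map_comp]
  exact MorphismProperty.comp_mem _ _ _ k₁ k₃

end Direct

/-! ### The telescope of a category and the contraction of its comma categories. -/

section Telescope

variable (K : Type w) [Category.{w} K]

/-- The telescope of a category `K`: objects are objects of `K` equipped with a natural number,
and nonidentity morphisms are morphisms in `K` that strictly raise this number. -/
structure Telescope where
  /-- the underlying object -/
  obj : K
  /-- the degree -/
  deg : ℕ

namespace Telescope

variable {K}

/-- Morphisms in the telescope. -/
inductive Hom : Telescope K → Telescope K → Type w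
  | id (x : Telescope K) : Hom x x
  | lt {x y : Telescope K} (f : x.obj ⟶ y.obj) (h : x.deg < y.deg) : Hom x y

/-- The composition of morphisms in the telescope. -/
def Hom.comp : ∀ {x y z : Telescope K}, Hom x y → Hom y z → Hom x z
  | _, _, _, .id _, g => g
  | _, _, _, .lt f h, .id _ => .lt f h
  | _, _, _, .lt f h, .lt g h' => .lt (f ≫ g) (h.trans h')

instance : Category.{w} (Telescope K) where
  Hom := Hom
  id := Hom.id
  comp := Hom.comp
  id_comp _ := rfl
  comp_id f := by cases f <;> rfl
  assoc f g h := by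
    cases f with
    | id => rfl
    | lt f hf =>
      cases g with
      | id => rfl
      | lt g hg =>
        cases h with
        | id => rfl
        | lt h hh => exact congrArg (fun k => Hom.lt k _) (Category.assoc f g h)

/-- A morphism in the telescope which raises the degree. -/
def homLT {x y : Telescope K} (f : x.obj ⟶ y.obj) (h : x.deg < y.deg) : x ⟶ y := Hom.lt f h

lemma hom_induction {motive : ∀ {x y : Telescope K}, (x ⟶ y) → Prop}
    (id : ∀ x : Telescope K, motive (𝟙 x))
    (lt : ∀ {x y : Telescope K} (f : x.obj ⟶ y.obj) (h : x.deg < y.deg), motive (homLT f h))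
    {x y : Telescope K} (f : x ⟶ y) : motive f :=
  Hom.rec (motive := fun y f => motive (x := x) (y := y) f) (id x) (fun f h => lt f h) f

/-- The morphism in `K` underlying a morphism in the telescope. -/
def Hom.toHom : ∀ {x y : Telescope K}, Hom x y → (x.obj ⟶ y.obj)
  | _, _, .id x => 𝟙 x.obj
  | _, _, .lt f _ => f

lemma toHom_comp {x y z : Telescope K} (f : x ⟶ y) (g : y ⟶ z) :
    Hom.toHom (f ≫ g) = Hom.toHom f ≫ Hom.toHom g := by
  induction f using hom_induction with
  | id => exact (Category.id_comp _).symm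
  | lt f hf =>
    induction g using hom_induction with
    | id => exact (Category.comp_id _).symm
    | lt g hg => rfl

variable (K) in
/-- The projection functor from the telescope. -/
def proj : Telescope K ⥤ K where
  obj x := x.obj
  map f := Hom.toHom f
  map_id _ := rfl
  map_comp := toHom_comp

lemma isDirect : IsDirect (deg (K := K)) := by
  intro d e f h
  induction f using hom_induction with
  | id => exact ⟨rfl, rfl⟩
  | lt f h' => omega

lemma deg_le {x y : Telescope K} (f : x ⟶ y) : x.deg ≤ y.deg := by
  induction f using hom_induction with
  | id => exact le_rfl
  | lt f h' => exact h'.le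

/-- The morphisms between shifted objects on the same object of `K`. -/
def shiftMap (k : K) : ∀ {x y : Telescope K}, Hom x y →
    ((⟨k, x.deg + 1⟩ : Telescope K) ⟶ ⟨k, y.deg + 1⟩)
  | _, _, .id _ => 𝟙 _
  | _, _, .lt _ h => homLT (𝟙 k) (Nat.succ_lt_succ h)

lemma shiftMap_comp (k : K) {x y z : Telescope K} (f : x ⟶ y) (g : y ⟶ z) :
    shiftMap k (f ≫ g) = shiftMap k f ≫ shiftMap k g := by
  induction f using hom_induction with
  | id => exact (Category.id_comp _).symm
  | lt f hf =>
    induction g using hom_induction with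
    | id => exact (Category.comp_id _).symm
    | lt g hg => exact congrArg (fun f => Hom.lt f _) (Category.id_comp (𝟙 k)).symm

lemma toHom_shiftMap (k : K) {x y : Telescope K} (f : x ⟶ y) :
    Hom.toHom (shiftMap k f) = 𝟙 k := by
  induction f using hom_induction <;> rfl

lemma homLT_comp {x y z : Telescope K} (f : x.obj ⟶ y.obj) (h : x.deg < y.deg) (g : y ⟶ z) :
    homLT f h ≫ g = homLT (f ≫ Hom.toHom g) (h.trans_le (deg_le g)) := by
  induction g using hom_induction with
  | id => exact congrArg (fun f => Hom.lt f _) (Category.comp_id f).symm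
  | lt => rfl

lemma comp_homLT {x y z : Telescope K} (f : x ⟶ y) (g : y.obj ⟶ z.obj) (h : y.deg < z.deg) :
    f ≫ homLT g h = homLT (Hom.toHom f ≫ g) ((deg_le f).trans_lt h) := by
  induction f using hom_induction with
  | id => exact congrArg (fun f => Hom.lt f _) (Category.id_comp g).symm
  | lt => rfl

variable (k : K)

/-- The objects of the comma categories of the telescope given by identities. -/
def overId (n : ℕ) : CostructuredArrow (proj K) k :=
  CostructuredArrow.mk (S := proj K) (Y := (⟨k, n⟩ : Telescope K)) (T := k) (𝟙 k)

/-- The shift on the comma categories of the telescope. -/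
def shift : CostructuredArrow (proj K) k ⥤ CostructuredArrow (proj K) k where
  -- The extra `1` leaves room for degree-raising maps both from `x` and from the base point of
  -- degree `0`.
  obj x := overId k (x.left.deg + 1)
  map f := CostructuredArrow.homMk (shiftMap k f.left)
    ((congrArg (fun g : k ⟶ k => g ≫ 𝟙 k) (toHom_shiftMap k f.left)).trans (Category.id_comp _))
  map_id _ := rfl
  map_comp f g := CostructuredArrow.hom_ext _ _ (shiftMap_comp k f.left g.left)

/-- The natural transformation to the shift. -/
def toShift : 𝟭 (CostructuredArrow (proj K) k) ⟶ shift k where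
  app x := CostructuredArrow.homMk
    (homLT (x := x.left) (y := ⟨k, x.left.deg + 1⟩) x.hom (Nat.lt_succ_self _)) (Category.comp_id _)
  naturality x y f := CostructuredArrow.hom_ext _ _ (by
    refine (comp_homLT f.left (z := ⟨k, y.left.deg + 1⟩) y.hom (Nat.lt_succ_self _)).trans ?_
    refine Eq.trans ?_ (homLT_comp (x := x.left) (y := ⟨k, x.left.deg + 1⟩)
      (z := ⟨k, y.left.deg + 1⟩) x.hom (Nat.lt_succ_self _) (shiftMap k f.left)).symm
    refine congrArg (fun f => Hom.lt f _) ((CostructuredArrow.w f).trans ?_)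
    rw [toHom_shiftMap]
    exact (Category.comp_id _).symm)

/-- The natural transformation from the base point to the shift. -/
def baseToShift : (Functor.const _).obj (overId k 0) ⟶ shift k where
  app x := CostructuredArrow.homMk
    (homLT (x := ⟨k, 0⟩) (y := ⟨k, x.left.deg + 1⟩) (𝟙 k) (Nat.succ_pos _)) (Category.comp_id _)
  naturality x y f := CostructuredArrow.hom_ext _ _ (by
    refine (Category.id_comp _).trans ?_
    refine Eq.trans ?_ (homLT_comp (x := ⟨k, 0⟩) (y := ⟨k, x.left.deg + 1⟩)
      (z := ⟨k, y.left.deg + 1⟩) (𝟙 k) (Nat.succ_pos _) (shiftMap k f.left)).symm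
    refine congrArg (fun f => Hom.lt f _) ?_
    rw [toHom_shiftMap]
    exact (Category.comp_id _).symm)

end Telescope

end Telescope

/-! ### Restriction to comma categories preserves projectivity. -/

section Comma

variable {D K : Type w} [Category.{w} D] [Category.{w} K] (p : D ⥤ K) (k : K)

lemma IsDirect.costructuredArrow {deg : D → ℕ} (hdeg : IsDirect deg) :
    IsDirect (fun x : CostructuredArrow p k => deg x.left) := by
  rintro ⟨x, ⟨⟨⟩⟩, u⟩ ⟨y, ⟨⟨⟩⟩, v⟩ f hf
  obtain ⟨h, h'⟩ := hdeg f.left hf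
  dsimp at h
  subst h
  have hw := CostructuredArrow.w f
  have : f.left = 𝟙 x := h'
  rw [this, p.map_id] at hw
  dsimp at hw
  rw [Category.id_comp] at hw
  subst hw
  exact ⟨rfl, CostructuredArrow.hom_ext _ _ this⟩

variable {M : Type u} [Category.{v} M] [HasProducts.{w} M]

variable {p k} in
lemma pi_π_comp_map_eq (U : CostructuredArrow p k ⥤ M) {d d' : D} {u₁ u₂ : p.obj d ⟶ k}
    {u' : p.obj d' ⟶ k} (φ₁ : CostructuredArrow.mk u₁ ⟶ CostructuredArrow.mk u')
    (φ₂ : CostructuredArrow.mk u₂ ⟶ CostructuredArrow.mk u') (h : φ₁.left = φ₂.left) :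
    Pi.π (fun u : p.obj d ⟶ k => U.obj (CostructuredArrow.mk u)) u₁ ≫ U.map φ₁ =
      Pi.π (fun u : p.obj d ⟶ k => U.obj (CostructuredArrow.mk u)) u₂ ≫ U.map φ₂ := by
  have hu₁ := CostructuredArrow.w φ₁
  have hu₂ := CostructuredArrow.w φ₂
  dsimp at hu₁ hu₂
  obtain rfl : u₁ = u₂ := by rw [← hu₁, ← hu₂, h]
  rw [CostructuredArrow.hom_ext φ₁ φ₂ h]

/-- The values of the right adjoint of the restriction along the projection from a comma
category. -/
noncomputable def commaPi (U : CostructuredArrow p k ⥤ M) : D ⥤ M where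
  obj d := ∏ᶜ fun u : p.obj d ⟶ k => U.obj (CostructuredArrow.mk u)
  map f := Pi.lift fun u' => Pi.π (fun u => U.obj (CostructuredArrow.mk u)) (p.map f ≫ u') ≫
    U.map (CostructuredArrow.homMk f rfl)
  map_id d := Pi.hom_ext _ _ fun u => by
    rw [Pi.lift_π]
    let φ : CostructuredArrow.mk (p.map (𝟙 d) ≫ u) ⟶ CostructuredArrow.mk u :=
      CostructuredArrow.homMk (𝟙 d) rfl
    refine (pi_π_comp_map_eq U φ (𝟙 (CostructuredArrow.mk u)) rfl).trans ?_
    rw [U.map_id, Category.id_comp]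
    exact Category.comp_id _
  map_comp f g := Pi.hom_ext _ _ fun u => by
    simp only [Pi.lift_π, Category.assoc, Pi.lift_π_assoc]
    rw [← U.map_comp]
    exact pi_π_comp_map_eq U _ _ rfl

variable {p k} in
/-- The projections from the values of `commaPi`. -/
noncomputable def commaPiπ (U : CostructuredArrow p k ⥤ M) {d : D} (u : p.obj d ⟶ k) :
    (commaPi p k U).obj d ⟶ U.obj (CostructuredArrow.mk u) :=
  Pi.π (fun u => U.obj (CostructuredArrow.mk u)) u

variable {p k} in
/-- Morphisms to the values of `commaPi`. -/
noncomputable def commaPiLift {U : CostructuredArrow p k ⥤ M} {d : D} {X : M}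
    (f : ∀ u : p.obj d ⟶ k, X ⟶ U.obj (CostructuredArrow.mk u)) : X ⟶ (commaPi p k U).obj d :=
  Pi.lift f

variable {p k} in
@[simp]
lemma commaPiLift_π {U : CostructuredArrow p k ⥤ M} {d : D} {X : M}
    (f : ∀ u : p.obj d ⟶ k, X ⟶ U.obj (CostructuredArrow.mk u)) (u : p.obj d ⟶ k) :
    commaPiLift f ≫ commaPiπ U u = f u :=
  Pi.lift_π _ _

variable {p k} in
@[simp]
lemma commaPiLift_π_assoc {U : CostructuredArrow p k ⥤ M} {d : D} {X Z : M}
    (f : ∀ u : p.obj d ⟶ k, X ⟶ U.obj (CostructuredArrow.mk u)) (u : p.obj d ⟶ k)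
    (g : U.obj (CostructuredArrow.mk u) ⟶ Z) :
    commaPiLift f ≫ commaPiπ U u ≫ g = f u ≫ g := by
  rw [← Category.assoc, commaPiLift_π]

variable {p k} in
lemma commaPi_hom_ext {U : CostructuredArrow p k ⥤ M} {d : D} {X : M}
    {f g : X ⟶ (commaPi p k U).obj d} (h : ∀ u, f ≫ commaPiπ U u = g ≫ commaPiπ U u) : f = g :=
  Pi.hom_ext _ _ h

variable {p k} in
lemma commaPi_map_π (U : CostructuredArrow p k ⥤ M) {d d' : D} (f : d ⟶ d') {u : p.obj d ⟶ k}
    {u' : p.obj d' ⟶ k} (φ : CostructuredArrow.mk u ⟶ CostructuredArrow.mk u')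
    (hφ : φ.left = f) :
    (commaPi p k U).map f ≫ commaPiπ U u' = commaPiπ U u ≫ U.map φ :=
  (Pi.lift_π _ _).trans (pi_π_comp_map_eq U _ _ hφ.symm)

variable {p k} in
lemma commaPi_map_π_assoc (U : CostructuredArrow p k ⥤ M) {d d' : D} (f : d ⟶ d')
    {u : p.obj d ⟶ k} {u' : p.obj d' ⟶ k}
    (φ : CostructuredArrow.mk u ⟶ CostructuredArrow.mk u') (hφ : φ.left = f) {Z : M}
    (g : U.obj (CostructuredArrow.mk u') ⟶ Z) :
    (commaPi p k U).map f ≫ commaPiπ U u' ≫ g = commaPiπ U u ≫ U.map φ ≫ g := by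
  rw [← Category.assoc, commaPi_map_π U f φ hφ, Category.assoc]

/-- The right adjoint of the restriction along the projection from a comma category. -/
noncomputable def commaPiFunctor : (CostructuredArrow p k ⥤ M) ⥤ (D ⥤ M) where
  obj U := commaPi p k U
  map {U V} α :=
    { app := fun d => commaPiLift fun u => commaPiπ U u ≫ α.app _
      naturality := fun d d' f => commaPi_hom_ext fun u => by
        let φ : CostructuredArrow.mk (p.map f ≫ u) ⟶ CostructuredArrow.mk u :=
          CostructuredArrow.homMk f rfl
        rw [Category.assoc, Category.assoc, commaPi_map_π V f φ rfl, commaPiLift_π,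
          commaPi_map_π_assoc U f φ rfl, commaPiLift_π_assoc, α.naturality, Category.assoc] }
  map_id U := by
    ext d
    exact commaPi_hom_ext fun u => by simp
  map_comp α β := by
    ext d
    exact commaPi_hom_ext fun u => by simp

/-- The restriction along the projection from a comma category is a left adjoint. -/
noncomputable def commaPiAdj :
    (Functor.whiskeringLeft _ _ M).obj (CostructuredArrow.proj p k) ⊣ commaPiFunctor p k :=
  Adjunction.mkOfHomEquiv
    { homEquiv := fun Y U =>
        { toFun := fun f =>
            { app := fun d => commaPiLift fun u => f.app (CostructuredArrow.mk u)
              naturality := fun d d' g => commaPi_hom_ext fun u => by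
                let φ : CostructuredArrow.mk (p.map g ≫ u) ⟶ CostructuredArrow.mk u :=
                  CostructuredArrow.homMk g rfl
                have := f.naturality φ
                refine (Category.assoc _ _ _).trans ?_
                refine (_ ≫= commaPiLift_π _ _).trans ?_
                refine Eq.trans ?_ (Category.assoc _ _ _).symm
                refine Eq.trans ?_ (_ ≫= commaPi_map_π U g φ rfl).symm
                exact this.trans (commaPiLift_π_assoc (U := U) (d := d) (X := Y.obj d)
                  (fun u => f.app (CostructuredArrow.mk u)) (p.map g ≫ u) (U.map φ)).symm }
          invFun := fun f =>
            { app := fun x => f.app x.left ≫ commaPiπ U x.hom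
              naturality := fun x y g => by
                have := f.naturality g.left =≫ commaPiπ U y.hom
                refine (Category.assoc _ _ _).symm.trans (this.trans ?_)
                refine ((Category.assoc _ _ _).trans ?_).trans (Category.assoc _ _ _).symm
                exact _ ≫= commaPi_map_π U g.left (u := x.hom) (u' := y.hom) g rfl }
          left_inv := fun f => by
            ext x
            exact commaPiLift_π _ _
          right_inv := fun f => by
            ext d
            exact commaPi_hom_ext fun u => commaPiLift_π _ _ }
      homEquiv_naturality_left_symm := fun f g => by
        ext x
        exact Category.assoc _ _ _
      homEquiv_naturality_right := fun {Y U V} f g => by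
        ext d
        refine commaPi_hom_ext fun u => ?_
        refine (commaPiLift_π _ _).trans ?_
        refine Eq.trans ?_ (Category.assoc _ _ _).symm
        refine Eq.trans ?_ (_ ≫= commaPiLift_π _ _).symm
        exact (commaPiLift_π_assoc (U := U) (d := d) (X := Y.obj d)
          (fun u => f.app (CostructuredArrow.mk u)) u (g.app _)).symm }

/-- The projection from the comma category is a discrete fibration, so the right adjoint of
restriction is a product over fibres and preserves objectwise `T`. -/
lemma IsProjectiveFor.comma {T : MorphismProperty M}
    [∀ J : Type w, T.IsStableUnderProductsOfShape J] {Y : D ⥤ M}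
    (hY : IsProjectiveFor (T.functorCategory D) Y) :
    IsProjectiveFor (T.functorCategory (CostructuredArrow p k))
      (CostructuredArrow.proj p k ⋙ Y) := by
  refine hY.map_of_adjunction (commaPiAdj p k) fun U V α hα d => ?_
  have := MorphismProperty.limMap (W := T)
    (X := Discrete.functor fun u : p.obj d ⟶ k => U.obj (CostructuredArrow.mk u))
    (Y := Discrete.functor fun u : p.obj d ⟶ k => V.obj (CostructuredArrow.mk u))
    (Discrete.natTrans fun u => α.app (CostructuredArrow.mk u.as)) (fun u => hα _)
  refine (congrArg (fun f => T f) ?_).mp this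
  exact commaPi_hom_ext fun u => (limMap_π _ _).trans
    (commaPiLift_π (U := V) (fun u => commaPiπ U u ≫ α.app (CostructuredArrow.mk u)) u).symm

end Comma

/-! ### Telescope resolutions through a left model approximation. -/

lemma weakEquivalences_le {M : Type u₁} [Category.{v₁} M] [ModelCategory M]
    {C : Type u₂} [Category.{v₂} C] {W : MorphismProperty C} {l : M ⥤ C} {r : C ⥤ M}
    (adj : l ⊣ r) (happrox : IsLeftModelApproximation W adj) :
    W ≤ (weakEquivalences M).inverseImage r :=
  fun _ _ g hg => (weakEquivalence_iff _).1 (happrox.map_right g hg)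

section

variable {M : Type u₁} [Category.{v₁} M] {C : Type u₂} [Category.{v₂} C] {D K : Type w}
  [Category.{w} D] [Category.{w} K]

/-- The composition of a left Kan extension functor and the left adjoint of a model
approximation. -/
abbrev lanComp (L : (D ⥤ M) ⥤ K ⥤ M) (l : M ⥤ C) : (D ⥤ M) ⥤ K ⥤ C :=
  L ⋙ (Functor.whiskeringRight K M C).obj l

/-- The composition of the right adjoint of a model approximation and a restriction functor. -/
abbrev resComp (q : D ⥤ K) (r : C ⥤ M) : (K ⥤ C) ⥤ D ⥤ M :=
  (Functor.whiskeringRight K C M).obj r ⋙ (Functor.whiskeringLeft D K M).obj q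

lemma resComp_le [ModelCategory M] {W : MorphismProperty C} {l : M ⥤ C} {r : C ⥤ M}
    (adj : l ⊣ r) (happrox : IsLeftModelApproximation W adj) (q : D ⥤ K) :
    W.functorCategory K ≤
      ((weakEquivalences M).functorCategory D).inverseImage (resComp q r) :=
  fun _ _ _ hf d => weakEquivalences_le adj happrox _ (hf (q.obj d))

lemma uncurry_resComp_le [ModelCategory M] {W : MorphismProperty C} {l : M ⥤ C} {r : C ⥤ M}
    (adj : l ⊣ r) (happrox : IsLeftModelApproximation W adj) {I J : Type w} [Category.{w} I]
    [Category.{w} J] {q : D ⥤ I × J} : (W.functorCategory J).functorCategory I ≤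
      ((weakEquivalences M).functorCategory D).inverseImage (Functor.uncurry ⋙ resComp q r) :=
  fun _ _ _ hf d => weakEquivalences_le adj happrox _ (hf (q.obj d).1 (q.obj d).2)

end

section Approximation

variable {M : Type u₁} [Category.{v₁} M] [ModelCategory M]
  [HasLimitsOfSize.{w, w} M] [HasColimitsOfSize.{w, w} M]

section

variable [MorphismProperty.HasFunctorialFactorization (cofibrations M) (trivialFibrations M)]
  {K : Type w} [Category.{w} K]

/-- Colimits over the comma categories of the telescope of projective diagrams that are objectwise
weakly equivalent to the restriction of a diagram on `K` compute the values of this diagram. -/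
lemma weakEquivalences_of_isColimit {Y : Telescope K ⥤ M}
    (hY : IsProjectiveFor ((trivialFibrations M).functorCategory _) Y) {G : K ⥤ M}
    (f : Y ⟶ Telescope.proj K ⋙ G) (hf : (weakEquivalences M).functorCategory _ f) (k : K)
    (c : Cocone (CostructuredArrow.proj (Telescope.proj K) k ⋙ Y)) (hc : IsColimit c)
    (g : c.pt ⟶ G.obj k) (hg : ∀ x, c.ι.app x ≫ g = f.app x.left ≫ G.map x.hom) :
    weakEquivalences M g := by
  let E := CostructuredArrow (Telescope.proj K) k
  let X : E ⥤ M := CostructuredArrow.proj (Telescope.proj K) k ⋙ Y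
  let T : E ⥤ M := CostructuredArrow.proj (Telescope.proj K) k ⋙ Telescope.proj K ⋙ G
  let α : X ⟶ T := Functor.whiskerLeft (CostructuredArrow.proj (Telescope.proj K) k) f
  let cT : Cocone T :=
    { pt := G.obj k
      ι := { app := fun x => G.map x.hom
             naturality := fun x y φ => by
               exact (G.map_comp _ _).symm.trans
                 ((congrArg G.map (CostructuredArrow.w φ)).trans (Category.comp_id _).symm) } }
  have hE : IsDirect (fun x : E => x.left.deg) := Telescope.isDirect.costructuredArrow _ k
  have hX : IsProjectiveFor ((trivialFibrations M).functorCategory E) X := hY.comma _ k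
  obtain ⟨Rep⟩ := nonempty_replacement (M := M) hE
  have good : IsGood (colimConstAdj (J := E) (C := M)) (const_le (weakEquivalences M)) X :=
    isGood_of_replacement Rep _ _
      (preservesWeakBetween_of_adjunction hE colimConstAdj (const_le _)) X hX
  have hb : ∀ x, weakEquivalences M (T.map ((Telescope.baseToShift k).app x)) := fun x => by
    have : T.map ((Telescope.baseToShift k).app x) = 𝟙 (G.obj k) := G.map_id k
    rw [this]
    exact MorphismProperty.id_mem _ _
  have hcT : weakEquivalences M (cT.ι.app (Telescope.overId k 0)) := by
    have : cT.ι.app (Telescope.overId k 0) = 𝟙 (G.obj k) := G.map_id k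
    rw [this]
    exact MorphismProperty.id_mem _ _
  have hα : IsIso (((weakEquivalences M).functorCategory E).Q.map α) :=
    Localization.inverts _ ((weakEquivalences M).functorCategory E) _ fun x => hf x.left
  -- Goodness makes the colimit of `X` a homotopy colimit, and the contraction makes `G.obj k` a
  -- homotopy colimit of the weakly equivalent diagram `T`.
  have key := isIso_Q_map_homEquiv_symm (colimConstAdj (J := E) (C := M)) _ good (α ≫ cT.ι)
    (fun b => by
      have e : Function.Bijective (fun φ :
          ((weakEquivalences M).functorCategory E).Q.obj T ⟶
            ((weakEquivalences M).functorCategory E).Q.obj ((Functor.const E).obj b) =>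
          ((weakEquivalences M).functorCategory E).Q.map α ≫ φ) :=
        ⟨fun _ _ h => (cancel_epi _).1 h, fun g =>
          ⟨inv (((weakEquivalences M).functorCategory E).Q.map α) ≫ g, by simp⟩⟩
      refine (congrArg Function.Bijective (funext fun φ => ?_)).mpr (e.comp
        (bijective_of_contraction (Telescope.toShift k) (Telescope.baseToShift k) hb cT hcT b))
      rw [Functor.map_comp]
      exact Category.assoc _ _ _)
  have h := isSaturated_weakEquivalences _ key
  have hg' : g = (hc.coconePointUniqueUpToIso (colimit.isColimit X)).hom ≫
      (colimConstAdj.homEquiv X (G.obj k)).symm (α ≫ cT.ι) := by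
    refine hc.hom_ext fun x => ?_
    rw [hg]
    erw [IsColimit.comp_coconePointUniqueUpToIso_hom_assoc]
    have := NatTrans.congr_app
      ((colimConstAdj.homEquiv X (G.obj k)).apply_symm_apply (α ≫ cT.ι)) x
    rw [Adjunction.homEquiv_unit] at this
    exact this.symm
  rw [hg']
  exact MorphismProperty.comp_mem _ _ _ (MorphismProperty.of_isIso _ _) h

end

section

variable {D K : Type w} [Category.{w} D] [Category.{w} K]

lemma whiskeringLeft_evaluationRightAdjoint_le {A : Type*} [Category* A] [HasProducts.{w} A]
    (T : MorphismProperty A) [∀ J : Type w, T.IsStableUnderProductsOfShape J] (q : D ⥤ K) (k : K) :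
    T ≤ (T.functorCategory D).inverseImage
      (evaluationRightAdjoint A k ⋙ (Functor.whiskeringLeft D K A).obj q) :=
  fun _ _ f hf d => evaluationRightAdjoint_le T k f hf (q.obj d)

/-- The values of left Kan extensions of projective diagrams are cofibrant. -/
lemma IsProjectiveFor.isCofibrant_obj {q : D ⥤ K} {L : (D ⥤ M) ⥤ K ⥤ M}
    (adjL : L ⊣ (Functor.whiskeringLeft D K M).obj q) {Y : D ⥤ M}
    (hY : IsProjectiveFor ((trivialFibrations M).functorCategory D) Y) (k : K) :
    IsCofibrant ((L.obj Y).obj k) := by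
  rw [isCofibrant_iff_isProjectiveFor]
  exact hY.map_of_adjunction (adjL.comp (evaluationAdjunctionLeft M k))
    (whiskeringLeft_evaluationRightAdjoint_le _ q k)

end

variable {C : Type u₂} [Category.{v₂} C] {W : MorphismProperty C} {l : M ⥤ C} {r : C ⥤ M}
  (adj : l ⊣ r) (happrox : IsLeftModelApproximation W adj)

section

variable {D K : Type w} [Category.{w} D] [Category.{w} K] {q : D ⥤ K} {L : (D ⥤ M) ⥤ K ⥤ M}
    (adjL : L ⊣ (Functor.whiskeringLeft D K M).obj q)

/-- The adjunction between `lanComp` and `resComp`. -/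
def lanCompAdj : lanComp L l ⊣ resComp q r := adjL.comp (adj.whiskerRight K)

-- Transposing across `L` first gives a map out of a cofibrant object, to which the adjoint axiom of
-- the approximation applies.
include happrox in
lemma mem_lanCompAdj_homEquiv_symm_app {Y : D ⥤ M}
    (hY : IsProjectiveFor ((trivialFibrations M).functorCategory D) Y) {F : K ⥤ C}
    (f : Y ⟶ (resComp q r).obj F) (k : K)
    (hf : weakEquivalences M (((adjL.homEquiv Y (F ⋙ r)).symm f).app k)) :
    W ((((lanCompAdj adj adjL).homEquiv Y F).symm f).app k) := by
  have h := happrox.adjoint _ (hY.isCofibrant_obj adjL k) ((weakEquivalence_iff _).2 hf)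
  refine (congrArg (fun f => W f) ?_).mp h
  rw [lanCompAdj, Adjunction.comp_homEquiv]
  refine (Adjunction.homEquiv_counit _ _ _ _).trans ?_
  refine Eq.trans ?_ (NatTrans.congr_app
    (Adjunction.homEquiv_counit (adj.whiskerRight K) _ _ _) k).symm
  simp

end

variable {K : Type w} [Category.{w} K]

include happrox in
lemma mem_telescope_homEquiv_symm
    [MorphismProperty.HasFunctorialFactorization (cofibrations M) (trivialFibrations M)]
    {Y : Telescope K ⥤ M} (hY : IsProjectiveFor ((trivialFibrations M).functorCategory _) Y)
    {F : K ⥤ C} (f : Y ⟶ (resComp (Telescope.proj K) r).obj F)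
    (hf : (weakEquivalences M).functorCategory _ f) :
    W.functorCategory K
      (((lanCompAdj adj ((Telescope.proj K).lanAdjunction M)).homEquiv Y F).symm f) := by
  intro k
  refine mem_lanCompAdj_homEquiv_symm_app adj happrox _ hY f k ?_
  refine weakEquivalences_of_isColimit hY f hf k _
    ((Telescope.proj K).isPointwiseLeftKanExtensionLeftKanExtensionUnit Y k) _ fun x => ?_
  have h := (((Telescope.proj K).lanAdjunction M).homEquiv Y (F ⋙ r)).apply_symm_apply f
  rw [Adjunction.homEquiv_unit, Functor.lanAdjunction_unit] at h
  have h' := NatTrans.congr_app h x.left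
  refine (Category.assoc _ _ _).trans ?_
  refine (_ ≫= ((((Telescope.proj K).lanAdjunction M).homEquiv Y (F ⋙ r)).symm f).naturality x.hom).trans
    ?_
  exact (Category.assoc _ _ _).symm.trans (h' =≫ _)

end Approximation

/-! ### Transport of goodness and comparison of derived functors. -/

section Deformation

variable {N A B : Type*} [Category* N] [Category* A] [Category* B]
  {WN : MorphismProperty N} {WA : MorphismProperty A} {WB : MorphismProperty B}

lemma isGood_map_of_replacement [WN.HasTwoOutOfThreeProperty] {P : ObjectProperty N}
    (Rep : Replacement WN P) {L : N ⥤ A} {R : A ⥤ N} (adj' : L ⊣ R) {F : A ⥤ B} {G : B ⥤ A}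
    (adj : F ⊣ G) (hR : WA ≤ WN.inverseImage R) (hG : WB ≤ WA.inverseImage G)
    (hL : PreservesWeakBetween WN P WA L) (hLF : PreservesWeakBetween WN P WB (L ⋙ F))
    {Y : N} (hY : P Y) : IsGood adj hG (L.obj Y) :=
  IsGood.of_comp adj hG adj' hR (fun _ _ _ hf => hR _ (hG _ hf))
    (isGood_of_replacement Rep adj' hR hL Y hY)
    (isGood_of_replacement Rep (adj'.comp adj) _ hLF Y hY)

namespace Replacement

variable {P : ObjectProperty N} (Rep : Replacement WN P) {L : N ⥤ A} {R : A ⥤ N} (adj' : L ⊣ R)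

/-- The deformation of the identity functor given by a replacement and an adjunction. -/
def deformation (L : N ⥤ A) (R : A ⥤ N) : A ⥤ A := R ⋙ Rep.functor ⋙ L

/-- The natural transformation from the deformation to the identity functor. -/
def deformationHom : Rep.deformation L R ⟶ 𝟭 A where
  app a := (adj'.homEquiv _ a).symm (Rep.hom.app (R.obj a))
  naturality a b f := by
    have := Rep.hom.naturality (R.map f)
    dsimp [deformation] at this ⊢
    rw [← Adjunction.homEquiv_naturality_left_symm, this,
      Adjunction.homEquiv_naturality_right_symm]

end Replacement

/-- Uniqueness of derived functors identifies the augmentation `t` with the one of the explicit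
model, which is `F.map (η.app X)`. -/
lemma isIso_Q_map_of_isLeftDerivedFunctor {F : A ⥤ B} {Θ : A ⥤ A} {η : Θ ⟶ 𝟭 A}
    (hη : ∀ X, WA (η.app X)) (hF : WA.IsInvertedBy (Θ ⋙ F ⋙ WB.Q))
    (hF' : ∀ X, IsIso (WB.Q.map (F.map (η.app (Θ.obj X))))) {h : A ⥤ B} {t : h ⟶ F}
    {H : WA.Localization ⥤ WB.Localization} {e : WA.Q ⋙ H ≅ h ⋙ WB.Q}
    (hH : H.IsLeftDerivedFunctor (F := F ⋙ WB.Q) (e.hom ≫ Functor.whiskerRight t WB.Q) WA)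
    {X : A} (hX : IsIso (WB.Q.map (F.map (η.app X)))) : IsIso (WB.Q.map (t.app X)) := by
  let H₀ := Localization.lift (Θ ⋙ F ⋙ WB.Q) hF WA.Q
  let α : WA.Q ⋙ H₀ ⟶ F ⋙ WB.Q :=
    (Localization.fac (Θ ⋙ F ⋙ WB.Q) hF WA.Q).hom ≫ Functor.whiskerRight η (F ⋙ WB.Q)
  have : H₀.IsLeftDerivedFunctor α WA :=
    isLeftDerivedFunctor_of_deformation (F ⋙ WB.Q) Θ η hη hF hF'
  let ε : WA.Q ⋙ H ⟶ F ⋙ WB.Q := e.hom ≫ Functor.whiskerRight t WB.Q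
  have hH' : H.IsLeftDerivedFunctor ε WA := hH
  let m := Functor.leftDerivedNatIso H H₀ ε α WA (Iso.refl _)
  have h₁ : m.hom.app (WA.Q.obj X) ≫ α.app X = ε.app X :=
    (Functor.leftDerived_fac_app H₀ α WA _ _ X).trans
      (NatTrans.congr_app (Category.comp_id _) X)
  have h₂ : IsIso (α.app X) := by
    dsimp [α]
    infer_instance
  have h₃ : WB.Q.map (t.app X) = e.inv.app X ≫ m.hom.app (WA.Q.obj X) ≫ α.app X := by
    rw [h₁]
    simp [ε]
  rw [h₃]
  infer_instance

end Deformation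

lemma RigidHocolim.map_mem {M : Type u₁} [Category.{v₁} M] [ModelCategory M]
    {C : Type u₂} [Category.{v₂} C] [HasColimitsOfSize.{w, w} C] {W : MorphismProperty C}
    {l : M ⥤ C} {r : C ⥤ M} (adj : l ⊣ r) (happrox : IsLeftModelApproximation W adj)
    (hW : IsWeakEquivalenceClass W) {K : Type w} [Category.{w} K] (h : RigidHocolim W K)
    {X Y : K ⥤ C} (f : X ⟶ Y) (hf : W.functorCategory K f) :
    W (h.functor.map f) := by
  obtain ⟨H, e, -⟩ := h.isTotalLeftDerived
  refine isSaturated_of_isLeftModelApproximation hW adj happrox _ ?_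
  have := Localization.inverts (W.functorCategory K).Q _ f hf
  have h₁ : IsIso (((W.functorCategory K).Q ⋙ H).map f) := by
    dsimp
    infer_instance
  exact (NatIso.isIso_map_iff e f).1 h₁

/-! ### Existence of homotopy colimits and their values on good diagrams. -/

section Hocolim

variable {M : Type u₁} [Category.{v₁} M] [ModelCategory M]
  [HasLimitsOfSize.{w, w} M] [HasColimitsOfSize.{w, w} M]
  {C : Type u₂} [Category.{v₂} C] {W : MorphismProperty C} {l : M ⥤ C} {r : C ⥤ M}
  (adj : l ⊣ r) (happrox : IsLeftModelApproximation W adj) (hW : IsWeakEquivalenceClass W)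

include hW in
lemma IsWeakEquivalenceClass.respectsIso : W.RespectsIso := by
  have := hW.twoOutOfThree
  exact MorphismProperty.respectsIso_of_isStableUnderComposition hW.isomorphisms_le

/-- The objects of the projective model structure on diagrams that are projective. -/
abbrev projectives (M : Type u₁) [Category.{v₁} M] [ModelCategory M] (D : Type w)
    [Category.{w} D] : ObjectProperty (D ⥤ M) :=
  IsProjectiveFor ((trivialFibrations M).functorCategory D)

section

variable {D : Type w} [Category.{w} D] {deg : D → ℕ} (hdeg : IsDirect deg)

include hW happrox hdeg in
lemma preservesWeakBetween_of_iso {T : (D ⥤ M) ⥤ M} {R : M ⥤ D ⥤ M} (adjT : T ⊣ R)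
    (hfib : fibrations M ≤ ((fibrations M).functorCategory D).inverseImage R)
    (htfib : trivialFibrations M ≤ ((trivialFibrations M).functorCategory D).inverseImage R)
    {T' : (D ⥤ M) ⥤ C} (e : T ⋙ l ≅ T') :
    PreservesWeakBetween ((weakEquivalences M).functorCategory D) (projectives M D) W T' := by
  intro X Y f hX hY hf
  have := hW.respectsIso
  have hc : ∀ {X : D ⥤ M}, projectives M D X → IsCofibrant (T.obj X) := fun hX => by
    rw [isCofibrant_iff_isProjectiveFor]
    exact hX.map_of_adjunction adjT htfib
  have h := happrox.map_left (T.map f) (hc hX) (hc hY) ((weakEquivalence_iff _).2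
    (preservesWeakBetween_of_adjunction hdeg adjT hfib f hX hY hf))
  exact (W.arrow_mk_iso_iff (Arrow.isoMk (e.app X) (e.app Y) (e.hom.naturality f).symm)).1 h

variable {K : Type w} [Category.{w} K] {q : D ⥤ K} {L : (D ⥤ M) ⥤ K ⥤ M}
    (adjL : L ⊣ (Functor.whiskeringLeft D K M).obj q)

include happrox hW hdeg adjL in
lemma preservesWeakBetween_lanComp :
    PreservesWeakBetween ((weakEquivalences M).functorCategory D) (projectives M D)
      (W.functorCategory K) (lanComp L l) := fun _ _ f hX hY hf k =>
  preservesWeakBetween_of_iso adj happrox hW hdeg (adjL.comp (evaluationAdjunctionLeft M k))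
    (whiskeringLeft_evaluationRightAdjoint_le _ q k)
    (whiskeringLeft_evaluationRightAdjoint_le _ q k)
    (Iso.refl (_ ⋙ l)) f hX hY hf

variable [HasColimitsOfSize.{w, w} C]

-- Since `l` preserves colimits, this functor is `L ⋙ colim` followed by `l`, and the right adjoint
-- of `L ⋙ colim` sends an object to a constant diagram.
include happrox hW hdeg adjL in
lemma preservesWeakBetween_lanComp_colim :
    PreservesWeakBetween ((weakEquivalences M).functorCategory D) (projectives M D)
      W (lanComp L l ⋙ colim) := by
  have := adj.leftAdjoint_preservesColimits
  exact preservesWeakBetween_of_iso adj happrox hW hdeg (adjL.comp colimConstAdj)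
    (fun _ _ _ hf _ => hf) (fun _ _ _ hf _ => hf)
    (Functor.isoWhiskerLeft L (preservesColimitNatIso l))

end

section

variable {K : Type w} [Category.{w} K]
  (Rep : Replacement ((weakEquivalences M).functorCategory (Telescope K))
    (projectives M (Telescope K)))

/-- The deformation of diagrams given by a replacement of diagrams on the telescope. -/
noncomputable abbrev telescopeDeformation (l : M ⥤ C) (r : C ⥤ M) : (K ⥤ C) ⥤ K ⥤ C :=
  Rep.deformation (lanComp ((Telescope.proj K).lan) l) (resComp (Telescope.proj K) r)

/-- The natural transformation from `telescopeDeformation` to the identity functor. -/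
noncomputable abbrev telescopeDeformationHom : telescopeDeformation Rep l r ⟶ 𝟭 (K ⥤ C) :=
  Rep.deformationHom (lanCompAdj adj ((Telescope.proj K).lanAdjunction M))

include happrox in
lemma telescopeDeformationHom_mem
    [MorphismProperty.HasFunctorialFactorization (cofibrations M) (trivialFibrations M)]
    (X : K ⥤ C) : W.functorCategory K ((telescopeDeformationHom adj Rep).app X) :=
  mem_telescope_homEquiv_symm adj happrox (Rep.obj_mem _) _ (Rep.hom_mem _)

variable [HasColimitsOfSize.{w, w} C]

include happrox hW in
lemma isGood_colim {D : Type w} [Category.{w} D] {deg : D → ℕ} (hdeg : IsDirect deg)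
    (Rep : Replacement ((weakEquivalences M).functorCategory D) (projectives M D))
    {q : D ⥤ K} {L : (D ⥤ M) ⥤ K ⥤ M}
    (adjL : L ⊣ (Functor.whiskeringLeft D K M).obj q) {Y : D ⥤ M} (hY : projectives M D Y) :
    IsGood (colimConstAdj (J := K) (C := C)) (const_le W) ((lanComp L l).obj Y) :=
  isGood_map_of_replacement Rep (lanCompAdj adj adjL) _ (resComp_le adj happrox q) _
    (preservesWeakBetween_lanComp adj happrox hW hdeg adjL)
    (preservesWeakBetween_lanComp_colim adj happrox hW hdeg adjL) hY

include happrox hW in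
lemma telescopeDeformation_colim_map_mem {X Y : K ⥤ C} (f : X ⟶ Y) (hf : W.functorCategory K f) :
    W (colim.map ((telescopeDeformation Rep l r).map f)) :=
  preservesWeakBetween_lanComp_colim adj happrox hW Telescope.isDirect
    ((Telescope.proj K).lanAdjunction M) _ (Rep.obj_mem _) (Rep.obj_mem _)
    (Rep.map_mem _ (resComp_le adj happrox _ _ hf))

variable [MorphismProperty.HasFunctorialFactorization (cofibrations M) (trivialFibrations M)]

include happrox hW in
lemma isIso_Q_colim_map_telescopeDeformationHom {X : K ⥤ C}
    (hX : IsGood (colimConstAdj (J := K) (C := C)) (const_le W) X) :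
    IsIso (W.Q.map (colim.map ((telescopeDeformationHom adj Rep).app X))) :=
  IsGood.isIso_Q_map _ _ (isGood_colim adj happrox hW Telescope.isDirect Rep
    ((Telescope.proj K).lanAdjunction M) (Rep.obj_mem _)) hX _
    (telescopeDeformationHom_mem adj happrox Rep X)

include happrox hW in
theorem nonempty_rigidHocolim (K : Type w) [Category.{w} K] : Nonempty (RigidHocolim W K) := by
  obtain ⟨Rep⟩ := nonempty_replacement (M := M) (D := Telescope K) Telescope.isDirect
  have hF : (W.functorCategory K).IsInvertedBy (telescopeDeformation Rep l r ⋙ colim ⋙ W.Q) :=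
    fun _ _ f hf => Localization.inverts W.Q W _
      (telescopeDeformation_colim_map_mem adj happrox hW Rep f hf)
  exact ⟨{
    functor := telescopeDeformation Rep l r ⋙ colim
    toColim := Functor.whiskerRight (telescopeDeformationHom adj Rep) colim
    isTotalLeftDerived := ⟨_, Localization.fac _ hF (W.functorCategory K).Q,
      isLeftDerivedFunctor_of_deformation (colim ⋙ W.Q) _ (telescopeDeformationHom adj Rep)
        (telescopeDeformationHom_mem adj happrox Rep) hF
        fun X => isIso_Q_colim_map_telescopeDeformationHom adj happrox hW Rep
          (isGood_colim adj happrox hW Telescope.isDirect Rep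
            ((Telescope.proj K).lanAdjunction M) (Rep.obj_mem _))⟩ }⟩

variable (h : RigidHocolim W K)

include happrox hW in
lemma RigidHocolim.toColim_mem {X : K ⥤ C}
    (hX : W (colim.map ((telescopeDeformationHom adj Rep).app X))) : W (h.toColim.app X) := by
  obtain ⟨H, e, hH⟩ := h.isTotalLeftDerived
  refine isSaturated_of_isLeftModelApproximation hW adj happrox _ ?_
  exact isIso_Q_map_of_isLeftDerivedFunctor (telescopeDeformationHom_mem adj happrox Rep)
    (fun _ _ f hf => Localization.inverts W.Q W _
      (telescopeDeformation_colim_map_mem adj happrox hW Rep f hf))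
    (fun X => isIso_Q_colim_map_telescopeDeformationHom adj happrox hW Rep
      (isGood_colim adj happrox hW Telescope.isDirect Rep
        ((Telescope.proj K).lanAdjunction M) (Rep.obj_mem _))) hH
    (Localization.inverts W.Q W _ hX)

include happrox hW in
lemma RigidHocolim.toColim_mem_of_isGood {X : K ⥤ C}
    (hX : IsGood (colimConstAdj (J := K) (C := C)) (const_le W) X) : W (h.toColim.app X) := by
  obtain ⟨Rep⟩ := nonempty_replacement (M := M) (D := Telescope K) Telescope.isDirect
  exact h.toColim_mem adj happrox hW Rep (isSaturated_of_isLeftModelApproximation hW adj happrox _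
    (isIso_Q_colim_map_telescopeDeformationHom adj happrox hW Rep hX))

end

end Hocolim

section Whiskering

variable {N : Type*} [Category* N] {WN : MorphismProperty N} {P : ObjectProperty N}

/-- The objectwise replacement of diagrams. -/
def Replacement.whiskeringRight (Rep : Replacement WN P) (I : Type*) [Category* I] :
    Replacement (WN.functorCategory I) (fun X => ∀ i, P (X.obj i)) where
  functor := (Functor.whiskeringRight I N N).obj Rep.functor
  hom :=
    { app := fun X => Functor.whiskerLeft X Rep.hom
      naturality := fun X Y f => by
        ext i
        exact Rep.hom.naturality (f.app i) }
  hom_mem X i := Rep.hom_mem (X.obj i)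
  obj_mem X i := Rep.obj_mem (X.obj i)

end Whiskering

/-! ### Fubini for strict colimits. -/

section IteratedColimits

variable {C : Type u₂} [Category.{v₂} C] [HasColimitsOfSize.{w, w} C]
  (I J : Type w) [Category.{w} I] [Category.{w} J]

variable (C) in
/-- The objectwise colimit functor. -/
noncomputable abbrev colimRight : (I ⥤ J ⥤ C) ⥤ I ⥤ C :=
  (Functor.whiskeringRight I (J ⥤ C) C).obj colim

variable (C) in
/-- The functor sending a diagram on a product to its iterated colimit. -/
noncomputable abbrev iteratedColim : (I × J ⥤ C) ⥤ C :=
  Functor.curry ⋙ colimRight C I J ⋙ colim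

variable (C) in
/-- The adjunction between currying and uncurrying. -/
def curryAdj : (Functor.curry : (I × J ⥤ C) ⥤ I ⥤ J ⥤ C) ⊣ Functor.uncurry :=
  Functor.currying.symm.toAdjunction

variable (C) in
/-- The adjunction between the iterated colimit functor and the constant diagrams functor. -/
noncomputable def iteratedColimAdj : iteratedColim C I J ⊣ Functor.const (I × J) :=
  ((curryAdj C I J).comp ((colimConstAdj.whiskerRight I).comp colimConstAdj)).ofNatIsoRight
    (NatIso.ofComponents (fun X => NatIso.ofComponents (fun _ => Iso.refl X)))

variable (C) in
/-- The iterated colimit functor is isomorphic to the colimit functor. -/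
noncomputable def iteratedColimIso : iteratedColim C I J ≅ colim :=
  (iteratedColimAdj C I J).leftAdjointUniq colimConstAdj

variable (C) in
/-- The restriction of diagrams along the swap functor. -/
abbrev swapRestriction : (I × J ⥤ C) ⥤ J × I ⥤ C :=
  (Functor.whiskeringLeft (J × I) (I × J) C).obj (CategoryTheory.Prod.swap J I)

variable (C) in
/-- The adjunction between the two swap restriction functors. -/
def swapAdj : swapRestriction C I J ⊣ swapRestriction C J I :=
  (CategoryTheory.Prod.braiding I J).toAdjunction.whiskerLeft C

variable (C) in
/-- The iterated colimit functor in the other order is isomorphic to the colimit functor. -/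
noncomputable def swapIteratedColimIso : swapRestriction C I J ⋙ iteratedColim C J I ≅ colim :=
  (((swapAdj C I J).comp (iteratedColimAdj C J I)).ofNatIsoRight (NatIso.ofComponents
    (G := Functor.const (I × J)) (fun X => NatIso.ofComponents (fun _ => Iso.refl X)))
    ).leftAdjointUniq colimConstAdj

end IteratedColimits

lemma iterate_map_mem {M : Type u₁} [Category.{v₁} M] [ModelCategory M]
    {C : Type u₂} [Category.{v₂} C] [HasColimitsOfSize.{w, w} C] {W : MorphismProperty C}
    {l : M ⥤ C} {r : C ⥤ M} (adj : l ⊣ r) (happrox : IsLeftModelApproximation W adj)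
    (hW : IsWeakEquivalenceClass W) {I J : Type w} [Category.{w} I] [Category.{w} J]
    (hI : RigidHocolim W I) (hJ : RigidHocolim W J) {X Y : I × J ⥤ C} (f : X ⟶ Y)
    (hf : W.functorCategory (I × J) f) : W ((iterate hI.functor hJ.functor).map f) :=
  hI.map_mem adj happrox hW _ fun i => hJ.map_mem adj happrox hW _ fun j => hf (i, j)

/-! ### Iterated homotopy colimits of resolved diagrams. -/

section Fubini

variable {M : Type u₁} [Category.{v₁} M] [ModelCategory M]
  [HasLimitsOfSize.{w, w} M] [HasColimitsOfSize.{w, w} M]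
  {C : Type u₂} [Category.{v₂} C] {W : MorphismProperty C} {l : M ⥤ C} {r : C ⥤ M}
  (adj : l ⊣ r) (happrox : IsLeftModelApproximation W adj) (hW : IsWeakEquivalenceClass W)
  {I J : Type w} [Category.{w} I] [Category.{w} J]

section

variable {D : Type w} [Category.{w} D] {deg : D → ℕ} (hdeg : IsDirect deg)
  {q : D ⥤ I × J} {L : (D ⥤ M) ⥤ I × J ⥤ M}
  (adjL : L ⊣ (Functor.whiskeringLeft D (I × J) M).obj q)

include happrox hW hdeg adjL in
lemma preservesWeakBetween_lanComp_curry :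
    PreservesWeakBetween ((weakEquivalences M).functorCategory D) (projectives M D)
      ((W.functorCategory J).functorCategory I) (lanComp L l ⋙ Functor.curry) :=
  fun _ _ f hX hY hf i j =>
    preservesWeakBetween_lanComp adj happrox hW hdeg adjL f hX hY hf (i, j)

lemma const_functorCategory_le : W.functorCategory I ≤
    ((W.functorCategory J).functorCategory I).inverseImage
      ((Functor.whiskeringRight I C (J ⥤ C)).obj (Functor.const J)) :=
  fun _ _ _ hf i _ => hf i

variable [HasColimitsOfSize.{w, w} C]

-- At each `i` this is `l` of a left Quillen functor. The right adjoint involves products, which is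
-- harmless here: only fibrations and trivial fibrations must be preserved.
include happrox hW hdeg adjL in
lemma preservesWeakBetween_lanComp_curry_colimRight :
    PreservesWeakBetween ((weakEquivalences M).functorCategory D) (projectives M D)
      (W.functorCategory I) ((lanComp L l ⋙ Functor.curry) ⋙ colimRight C I J) := by
  intro X Y f hX hY hf i
  have := adj.leftAdjoint_preservesColimits
  have hR (T : MorphismProperty M) [∀ K : Type w, T.IsStableUnderProductsOfShape K] :
      T ≤ (T.functorCategory D).inverseImage
        ((((Functor.const J ⋙ evaluationRightAdjoint (J ⥤ M) i) ⋙ Functor.uncurry) ⋙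
          (Functor.whiskeringLeft D (I × J) M).obj q)) := fun _ _ f hf d =>
    evaluationRightAdjoint_le (T.functorCategory J) i ((Functor.const J).map f) (fun _ => hf)
      (q.obj d).1 (q.obj d).2
  let e : (L ⋙ Functor.curry ⋙ (evaluation I (J ⥤ M)).obj i ⋙ colim) ⋙ l ≅
      ((lanComp L l ⋙ Functor.curry) ⋙ colimRight C I J) ⋙ (evaluation I C).obj i :=
    Functor.isoWhiskerLeft (L ⋙ Functor.curry ⋙ (evaluation I (J ⥤ M)).obj i)
      (preservesColimitNatIso l)
  exact preservesWeakBetween_of_iso adj happrox hW hdeg (adjL.comp ((curryAdj M I J).comp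
    ((evaluationAdjunctionLeft (J ⥤ M) i).comp colimConstAdj))) (hR _) (hR _) e f hX hY hf

include happrox hW hdeg adjL in
lemma preservesWeakBetween_lanComp_iteratedColim :
    PreservesWeakBetween ((weakEquivalences M).functorCategory D) (projectives M D)
      W ((((lanComp L l ⋙ Functor.curry) ⋙ colimRight C I J)) ⋙ colim) := by
  have := adj.leftAdjoint_preservesColimits
  exact preservesWeakBetween_of_iso adj happrox hW hdeg (adjL.comp colimConstAdj)
    (fun _ _ _ hf _ => hf) (fun _ _ _ hf _ => hf)
    (Functor.isoWhiskerLeft L (preservesColimitNatIso l) ≪≫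
      Functor.isoWhiskerLeft (lanComp L l) (iteratedColimIso C I J).symm)

variable (Rep : Replacement ((weakEquivalences M).functorCategory D) (projectives M D))
  (hI : RigidHocolim W I) (hJ : RigidHocolim W J)
  {Y : D ⥤ M} (hY : projectives M D Y)

include happrox hW hdeg adjL Rep hY in
lemma isGood_colimRight_lanComp :
    IsGood (colimConstAdj.whiskerRight I) (const_functorCategory_le (W := W) (I := I) (J := J))
      ((lanComp L l ⋙ Functor.curry).obj Y) :=
  isGood_map_of_replacement Rep ((lanCompAdj adj adjL).comp (curryAdj C I J)) _
    (uncurry_resComp_le adj happrox) _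
    (preservesWeakBetween_lanComp_curry adj happrox hW hdeg adjL)
    (preservesWeakBetween_lanComp_curry_colimRight adj happrox hW hdeg adjL) hY

include happrox hW in
lemma isGood_colimRight_telescopeDeformation
    (RepJ : Replacement ((weakEquivalences M).functorCategory (Telescope J))
      (projectives M (Telescope J))) (X : I ⥤ J ⥤ C) :
    IsGood (colimConstAdj.whiskerRight I) (const_functorCategory_le (W := W) (I := I) (J := J))
      (X ⋙ telescopeDeformation RepJ l r) :=
  isGood_map_of_replacement (WA := (W.functorCategory J).functorCategory I)
    (WB := W.functorCategory I) (F := colimRight C I J) (RepJ.whiskeringRight I)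
    ((lanCompAdj adj ((Telescope.proj J).lanAdjunction M)).whiskerRight I) _
    (fun _ _ _ hf i => resComp_le adj happrox _ _ (hf i)) _
    (fun _ _ f hX hY hf i => preservesWeakBetween_lanComp adj happrox hW Telescope.isDirect
      ((Telescope.proj J).lanAdjunction M) (f.app i) (hX i) (hY i) (hf i))
    (fun _ _ f hX hY hf i => preservesWeakBetween_lanComp_colim adj happrox hW Telescope.isDirect
      ((Telescope.proj J).lanAdjunction M) (f.app i) (hX i) (hY i) (hf i))
    (Y := X ⋙ resComp (Telescope.proj J) r ⋙ RepJ.functor) (fun _ => RepJ.obj_mem _)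

include happrox hW hdeg adjL Rep hY in
lemma isGood_colim_colimRight_lanComp :
    IsGood (colimConstAdj (J := I) (C := C)) (const_le W)
      (((lanComp L l ⋙ Functor.curry) ⋙ colimRight C I J).obj Y) :=
  isGood_map_of_replacement Rep
    (((lanCompAdj adj adjL).comp (curryAdj C I J)).comp (colimConstAdj.whiskerRight I)) _
    (fun _ _ _ hf => uncurry_resComp_le adj happrox _ (const_functorCategory_le _ hf)) _
    (preservesWeakBetween_lanComp_curry_colimRight adj happrox hW hdeg adjL)
    (preservesWeakBetween_lanComp_iteratedColim adj happrox hW hdeg adjL) hY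

variable [MorphismProperty.HasFunctorialFactorization (cofibrations M) (trivialFibrations M)]

-- Goodness of a single row is not available this way, since the right adjoint of evaluation need
-- not preserve weak equivalences. Instead, all rows are compared with their telescope deformations
-- as one `I`-diagram; both are good for objectwise colimits, and saturation gives the result at
-- each `i`.
include happrox hW hdeg adjL Rep hY in
lemma RigidHocolim.toColim_curry_obj_mem (i : I) :
    W (hJ.toColim.app ((Functor.curry.obj ((lanComp L l).obj Y)).obj i)) := by
  obtain ⟨RepJ⟩ := nonempty_replacement (M := M) (D := Telescope J) Telescope.isDirect
  refine hJ.toColim_mem adj happrox hW RepJ ?_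
  have h := IsGood.isIso_Q_map _ _
    (isGood_colimRight_telescopeDeformation adj happrox hW RepJ _)
    (isGood_colimRight_lanComp adj happrox hW hdeg adjL Rep hY)
    (Functor.whiskerLeft (Functor.curry.obj ((lanComp L l).obj Y))
      (telescopeDeformationHom adj RepJ))
    (fun i => telescopeDeformationHom_mem adj happrox RepJ _)
  exact (isSaturated_of_isLeftModelApproximation hW adj happrox).functorCategory I _ h i

/-- The natural transformation from an iterated homotopy colimit to the iterated colimit. -/
noncomputable def iterateToColim :
    iterate hI.functor hJ.functor ⟶ iteratedColim C I J :=
  Functor.whiskerLeft Functor.curry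
    (Functor.whiskerRight ((Functor.whiskeringRight I (J ⥤ C) C).map hJ.toColim) hI.functor ≫
      Functor.whiskerLeft (colimRight C I J) hI.toColim)

-- The inner map is a weak equivalence on each row and is preserved by `hI.functor`; the outer one
-- is evaluated at a good diagram.
include happrox hW hdeg adjL Rep hY in
lemma iterateToColim_mem : W ((iterateToColim hI hJ).app ((lanComp L l).obj Y)) := by
  have := hW.twoOutOfThree
  exact W.comp_mem _ _ (hI.map_mem adj happrox hW _
      (hJ.toColim_curry_obj_mem adj happrox hW hdeg adjL Rep hY))
    (hI.toColim_mem_of_isGood adj happrox hW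
      (isGood_colim_colimRight_lanComp adj happrox hW hdeg adjL Rep hY))

end

section

variable [HasColimitsOfSize.{w, w} C]
  [MorphismProperty.HasFunctorialFactorization (cofibrations M) (trivialFibrations M)]
  {K : Type w} [Category.{w} K]
  (Rep : Replacement ((weakEquivalences M).functorCategory (Telescope K))
    (projectives M (Telescope K)))

-- Two legs through `Θ ⋙ G`: one uses that `G` preserves weak equivalences, the other that `τ` is a
-- weak equivalence on resolved diagrams.
include happrox hW in
lemma weaklyEquivalent_telescopeDeformation_colim {G G' : (K ⥤ C) ⥤ C}
    (hG : ∀ ⦃X Y : K ⥤ C⦄ (f : X ⟶ Y), W.functorCategory K f → W (G.map f)) (τ : G ⟶ G')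
    (hτ : ∀ Y, projectives M (Telescope K) Y →
      W (τ.app ((lanComp ((Telescope.proj K).lan) l).obj Y))) (e : G' ≅ colim) :
    WeaklyEquivalent (W.functorCategory (K ⥤ C)) G (telescopeDeformation Rep l r ⋙ colim) := by
  have := hW.respectsIso
  refine .trans _ (telescopeDeformation Rep l r ⋙ G) _ (.symm _ _ (.rel _ _
    ⟨Functor.whiskerRight (telescopeDeformationHom adj Rep) G, fun X =>
      hG _ (telescopeDeformationHom_mem adj happrox Rep X)⟩)) (.rel _ _
    ⟨Functor.whiskerLeft _ (τ ≫ e.hom), fun X => ?_⟩)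
  exact (W.cancel_right_of_respectsIso _ (e.hom.app _)).2 (hτ _ (Rep.obj_mem _))

end

end Fubini

end HocolimFubini

theorem mainTheorem4
    {M : Type u₁} [Category.{v₁} M] [ModelCategory M]
    [HasLimitsOfSize.{w, w} M] [HasColimitsOfSize.{w, w} M]
    [MorphismProperty.HasFunctorialFactorization (cofibrations M) (trivialFibrations M)]
    {C : Type u₂} [Category.{v₂} C] [HasColimitsOfSize.{w, w} C]
    (W : MorphismProperty C) (hW : HocolimFubini.IsWeakEquivalenceClass W)
    {l : M ⥤ C} {r : C ⥤ M} (adj : l ⊣ r)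
    (happrox : HocolimFubini.IsLeftModelApproximation W adj)
    (I J : Type w) [Category.{w} I] [Category.{w} J] :
    (Nonempty (HocolimFubini.RigidHocolim W (I × J)) ∧
      Nonempty (HocolimFubini.RigidHocolim W I) ∧
      Nonempty (HocolimFubini.RigidHocolim W J)) ∧
    ∀ (hocolimIJ : HocolimFubini.RigidHocolim W (I × J))
      (hocolimI : HocolimFubini.RigidHocolim W I)
      (hocolimJ : HocolimFubini.RigidHocolim W J),
      HocolimFubini.WeaklyEquivalent (W.functorCategory (I × J ⥤ C))
        hocolimIJ.functor
        (HocolimFubini.iterate hocolimI.functor hocolimJ.functor) ∧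
      HocolimFubini.WeaklyEquivalent (W.functorCategory (I × J ⥤ C))
        (HocolimFubini.iterate hocolimI.functor hocolimJ.functor)
        (HocolimFubini.iterate' hocolimI.functor hocolimJ.functor) := by
  open HocolimFubini in
  refine ⟨⟨nonempty_rigidHocolim adj happrox hW _, nonempty_rigidHocolim adj happrox hW _,
    nonempty_rigidHocolim adj happrox hW _⟩, fun hIJ hI hJ => ?_⟩
  obtain ⟨Rep⟩ := nonempty_replacement (M := M) (D := Telescope (I × J)) Telescope.isDirect
  have h₁ := weaklyEquivalent_telescopeDeformation_colim adj happrox hW Rep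
    (fun _ _ f hf => hIJ.map_mem adj happrox hW f hf) hIJ.toColim
    (fun Y hY => hIJ.toColim_mem_of_isGood adj happrox hW
      (isGood_colim adj happrox hW Telescope.isDirect Rep
        ((Telescope.proj _).lanAdjunction M) hY)) (Iso.refl _)
  have h₂ := weaklyEquivalent_telescopeDeformation_colim adj happrox hW Rep
    (fun _ _ f hf => iterate_map_mem adj happrox hW hI hJ f hf) (iterateToColim hI hJ)
    (fun Y hY => iterateToColim_mem adj happrox hW Telescope.isDirect
      ((Telescope.proj _).lanAdjunction M) Rep hI hJ hY) (iteratedColimIso C I J)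
  have h₃ := weaklyEquivalent_telescopeDeformation_colim adj happrox hW Rep
    (G := iterate' hI.functor hJ.functor)
    (fun _ _ f hf => iterate_map_mem adj happrox hW hJ hI _ (fun x => hf (x.2, x.1)))
    (Functor.whiskerLeft (swapRestriction C I J) (iterateToColim hJ hI))
    (fun Y hY => iterateToColim_mem adj happrox hW Telescope.isDirect
      -- The telescope of `I × J` is kept and only its projection is swapped, so the same
      -- deformation serves both orders.
      (q := Telescope.proj _ ⋙ CategoryTheory.Prod.swap I J)
      (L := (Telescope.proj _).lan ⋙ swapRestriction M I J)
      (((Telescope.proj _).lanAdjunction M).comp (swapAdj M I J)) Rep hJ hI hY)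
    (swapIteratedColimIso C I J)
  exact ⟨h₁.trans _ _ _ (h₂.symm _ _), h₂.trans _ _ _ (h₃.symm _ _)⟩
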